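/- Let $n\ge 1$ and let $L(\mathfrak{sl}_{2n+1})=\mathfrak{sl}_{2n+1}(\mathbb C)\otimes\mathbb C[t,t^{-1}]$, with matrix units $E_{a,b}$, $1\le a,b\le 2n+1$, and put $i'=2n+2-i$. Let $\mathfrak g\subset L(\mathfrak{sl}_{2n+1})$ be the Lie algebra of type $C_n$ (of type $A_1$ if $n=1$) generated by its root vectors $x_{\pm\alpha}$, $\alpha\in R^+$, where $$x_{\varepsilon_i-\varepsilon_j}=E_{i,j}-(-1)^{i+j}E_{j',i'},\qquad x_{-(\varepsilon_i-\varepsilon_j)}=E_{j,i}-(-1)^{i+j}E_{i',j'}\qquad(1\le i<j\le n),$$ $$x_{\pm(\varepsilon_i+\varepsilon_j)}=X^{\pm}\otimes t^{\pm1},\quad X^+=E_{i,j'}+(-1)^{i+j}E_{j,i'},\quad X^-=E_{j',i}+(-1)^{i+j}E_{i',j}\qquad(1\le i<j\le n),$$ $$x_{2\varepsilon_i}=E_{i,i'}\otimes t,\qquad x_{-2\varepsilon_i}=E_{i',i}\otimes t^{-1}\qquad(1\le i\le n).$$ Let $\alpha^\vee=[x_\alpha,x_{-\alpha}]$, and let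 $\mathfrak h$ be the span of the coroots $\alpha^\vee$, $\alpha\in R^+$. The simple roots are $\alpha_i=\varepsilon_i-\varepsilon_{i+1}$ ($1\le i<n$) and $\alpha_n=2\varepsilon_n$. The hyperspecial current algebra $\mathcal C\mathfrak g$ of type $A_{2n}^{(2)}$ is the Lie subalgebra of $L(\mathfrak{sl}_{2n+1})$ generated by $\mathfrak g$ and $x_0^+=E_{n+1,1}-E_{2n+1,n+1}$. Let $\mathcal C\mathfrak n^+$ be the subspace of strictly upper triangular matrices in $\mathcal C\mathfrak g$, and let $\mathcal C\mathfrak h_+$ be the (abelian) subalgebra of diagonal matrices in $\mathcal C\mathfrak g$ with entries in $t\,\mathbb C[t]$. Let $\lambda\in P^+$, that is, $\lambda\in\mathfrak h^*$ with $\lambda(\alpha_i^\vee)\in\mathbb Z_{\ge0}$ for $1\le i\le n$. The global Weyl module $W(\lambda)$ is the left $U(\mathcal C\mathfrak g)$-module generated by an element $w_\lambda$ with the relations $$\mathcal C\mathfrak n^+w_\lambda=0,\qquad hw_\lambda=\lambda(h)w_\lambda\ (h\in\mathfrak h),\qquad x_{-\alpha}^{\lambda(\alpha^\vee)+1}w_\lambda=0\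 (\alpha\in R^+).$$ There is a well-defined right action of $U(\mathcal C\mathfrak h_+)$ on $W(\lambda)$ given by $(yw_\lambda)u=yuw_\lambda$ for $y\in U(\mathcal C\mathfrak g)$, $u\in U(\mathcal C\mathfrak h_+)$. Let $\mathbf A_\lambda=U(\mathcal C\mathfrak h_+)/\{u: w_\lambda u=0\}$, a commutative algebra, so that $W(\lambda)$ is a right $\mathbf A_\lambda$-module. For a maximal ideal $\mathbf I$ of $\mathbf A_\lambda$, the local Weyl module is $W(\lambda,\mathbf I)=W(\lambda)\otimes_{\mathbf A_\lambda}\mathbf A_\lambda/\mathbf I$. Then, for every $\lambda\in P^+$, the global Weyl module $W(\lambda)$ is a finitely generated right $\mathbf A_\lambda$-module, and for every maximal ideal $\mathbf I$ of $\mathbf A_\lambda$ the local Weyl module $W(\lambda,\mathbf I)$ is finite-dimensional over $\mathbb C$. -/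

import Mathlib

open scoped TensorProduct LaurentPolynomial

attribute [local instance] LieRing.ofAssociativeRing

set_option linter.unusedSimpArgs false

noncomputable section

namespace HyperspecialA

/-! ### The current algebra -/

/-- The Lie algebra `gl_{2n+1} ⊗ ℂ[t, t⁻¹]` of square matrices of size `2n+1` over the Laurent
polynomials, with the commutator bracket.  The loop algebra `L(sl_{2n+1})` is the subalgebra of its
trace zero matrices; all the elements used below have trace zero.
Rows and columns are numbered `0, …, 2n`. -/
abbrev LoopMat (n : ℕ) : Type := Matrix (Fin (2 * n + 1)) (Fin (2 * n + 1)) ℂ[T;T⁻¹]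

/-- The index `i ∈ {0, …, n-1}` as a matrix index in the first half. -/
def lo {n : ℕ} (i : Fin n) : Fin (2 * n + 1) := ⟨i, by omega⟩

/-- The index `2n - i`, the mirror image of `i`, as a matrix index in the second half. -/
def hi {n : ℕ} (i : Fin n) : Fin (2 * n + 1) := ⟨2 * n - i, by omega⟩

/-- The middle matrix index `n`. -/
def mid (n : ℕ) : Fin (2 * n + 1) := ⟨n, by omega⟩

/-- The matrix `c E_{a,b} ⊗ t^k`. -/
def el {n : ℕ} (a b : Fin (2 * n + 1)) (c : ℂ) (k : ℤ) : LoopMat n :=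
  Matrix.single a b (LaurentPolynomial.C c * LaurentPolynomial.T k)

/-- The positive roots of the root system of type `C_n` (`A_1` if `n = 1`), in the usual
coordinates `ε_0, …, ε_{n-1}`.  The simple roots are `ε_i - ε_{i+1}` (`i + 1 < n`) and
`2ε_{n-1}`. -/
inductive PosRoot (n : ℕ) : Type
  /-- the short root `ε_i - ε_j` -/
  | sub (i j : Fin n) (h : i < j) : PosRoot n
  /-- the short root `ε_i + ε_j` -/
  | add (i j : Fin n) (h : i < j) : PosRoot n
  /-- the long root `2ε_i` -/
  | long (i : Fin n) : PosRoot n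

/-- The root vector `x_α`, `α` a positive root. -/
def rootVec {n : ℕ} : PosRoot n → LoopMat n
  | .sub i j _ => el (lo i) (lo j) 1 0 - el (hi j) (hi i) ((-1) ^ (i.val + j.val)) 0
  | .add i j _ => el (lo i) (hi j) 1 1 + el (lo j) (hi i) ((-1) ^ (i.val + j.val)) 1
  | .long i => el (lo i) (hi i) 1 1

/-- The root vector `x_{-α}`, `α` a positive root. -/
def rootVecNeg {n : ℕ} : PosRoot n → LoopMat n
  | .sub i j _ => el (lo j) (lo i) 1 0 - el (hi i) (hi j) ((-1) ^ (i.val + j.val)) 0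
  | .add i j _ => el (hi j) (lo i) 1 (-1) + el (hi i) (lo j) ((-1) ^ (i.val + j.val)) (-1)
  | .long i => el (hi i) (lo i) 1 (-1)

/-- The vector `x_0^+ = E_{n+1,1} - E_{2n+1,n+1}` (one-based numbering of rows and columns), a root
vector for the affine simple root `α_0`. -/
def affineVec (n : ℕ) : LoopMat n :=
  el (mid n) 0 1 0 - el (Fin.last (2 * n)) (mid n) 1 0

/-- The simple Lie algebra `𝔤` of type `C_n` (`A_1` if `n = 1`) realized in the loop algebra: it is
generated by its root vectors `x_{±α}`. -/
def finiteAlg (n : ℕ) : LieSubalgebra ℂ (LoopMat n) :=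
  LieSubalgebra.lieSpan ℂ (LoopMat n) (Set.range rootVec ∪ Set.range rootVecNeg)

/-- The hyperspecial current algebra `C𝔤` of type `A_{2n}^{(2)}`: the Lie subalgebra of the loop
algebra `L(sl_{2n+1})` generated by `𝔤` and `x_0^+`. -/
def currentAlg (n : ℕ) : LieSubalgebra ℂ (LoopMat n) :=
  LieSubalgebra.lieSpan ℂ (LoopMat n) ((finiteAlg n : Set (LoopMat n)) ∪ {affineVec n})

/-- The underlying matrix of an element of the current algebra. -/
def mat {n : ℕ} (x : currentAlg n) : LoopMat n := x.1

/-- `x_α ∈ C𝔤` for a positive root `α`. -/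
def xPos {n : ℕ} (α : PosRoot n) : currentAlg n :=
  ⟨rootVec α, LieSubalgebra.subset_lieSpan (Or.inl (LieSubalgebra.subset_lieSpan
    (Or.inl ⟨α, rfl⟩)))⟩

/-- `x_{-α} ∈ C𝔤` for a positive root `α`. -/
def xNeg {n : ℕ} (α : PosRoot n) : currentAlg n :=
  ⟨rootVecNeg α, LieSubalgebra.subset_lieSpan (Or.inl (LieSubalgebra.subset_lieSpan
    (Or.inr ⟨α, rfl⟩)))⟩

/-- The coroot `α^∨ = [x_α, x_{-α}]` of a positive root `α`. -/
def coroot {n : ℕ} (α : PosRoot n) : currentAlg n := ⁅xPos α, xNeg α⁆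

/-- The Cartan subalgebra `𝔥` of `𝔤`, spanned by the coroots. -/
def cartan (n : ℕ) : Submodule ℂ (currentAlg n) := Submodule.span ℂ (Set.range coroot)

/-- The coroot `α^∨` as an element of `𝔥`. -/
def corootH {n : ℕ} (α : PosRoot n) : cartan n := ⟨coroot α, Submodule.subset_span ⟨α, rfl⟩⟩

/-- The simple roots `α_1, …, α_n` (indexed from `0`): `ε_i - ε_{i+1}` for `i < n - 1`, and
`2ε_{n-1}`. -/
def simpleRoot {n : ℕ} (i : Fin n) : PosRoot n :=
  if h : i.val + 1 < n then .sub i ⟨i + 1, h⟩ (Nat.lt_succ_self i.val) else .long i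

/-- `λ ∈ P^+`: the values of `λ ∈ 𝔥^*` on the simple coroots are non-negative integers. -/
def IsDominantIntegral {n : ℕ} (wt : Module.Dual ℂ (cartan n)) : Prop :=
  ∀ i : Fin n, ∃ m : ℕ, wt (corootH (simpleRoot i)) = m

/-- `C𝔫^+`, the sum of the root spaces of `C𝔤` whose `𝔥`-weight is a positive root or half of a
positive long root: the elements of `C𝔤` that are strictly upper triangular matrices. -/
def nPlus (n : ℕ) : Submodule ℂ (currentAlg n) where
  carrier := {x | ∀ a b, b ≤ a → mat x a b = 0}
  add_mem' {x y} hx hy a b hab := by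
    have h : mat (x + y) = mat x + mat y := rfl
    rw [h, Matrix.add_apply, hx a b hab, hy a b hab, add_zero]
  zero_mem' a b _ := rfl
  smul_mem' c x hx a b hab := by
    have h : mat (c • x) = c • mat x := rfl
    rw [h, Matrix.smul_apply, hx a b hab, smul_zero]

theorem diag_bracket {n : ℕ} {A B : LoopMat n} (hA : ∀ a b, a ≠ b → A a b = 0)
    (hB : ∀ a b, a ≠ b → B a b = 0) : A * B - B * A = 0 := by
  have h1 : A = Matrix.diagonal (fun a => A a a) := by
    ext1 a b
    by_cases h : a = b
    · subst h; simp
    · rw [hA a b h, Matrix.diagonal_apply_ne _ h]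
  have h2 : B = Matrix.diagonal (fun a => B a a) := by
    ext1 a b
    by_cases h : a = b
    · subst h; simp
    · rw [hB a b h, Matrix.diagonal_apply_ne _ h]
  rw [h1, h2, Matrix.diagonal_mul_diagonal, Matrix.diagonal_mul_diagonal, sub_eq_zero]
  congr 1
  ext1 a
  exact mul_comm _ _

/-- `C𝔥_+ = ⊕_{k > 0} ĝ_{kδ}`: the elements of `C𝔤` that are diagonal matrices with entries
in `t ℂ[t]`. -/
def hPlus (n : ℕ) : LieSubalgebra ℂ (currentAlg n) where
  carrier := {x | (∀ a b, a ≠ b → mat x a b = 0) ∧ ∀ a, ∀ k : ℤ, k ≤ 0 → (mat x a a).coeff k = 0}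
  add_mem' {x y} hx hy := by
    have h : mat (x + y) = mat x + mat y := rfl
    refine ⟨fun a b hab => ?_, fun a k hk => ?_⟩
    · rw [h, Matrix.add_apply, hx.1 a b hab, hy.1 a b hab, add_zero]
    · rw [h, Matrix.add_apply, AddMonoidAlgebra.coeff_add, Finsupp.add_apply, hx.2 a k hk,
        hy.2 a k hk, add_zero]
  zero_mem' := ⟨fun a b _ => rfl, fun a k _ => rfl⟩
  smul_mem' c x hx := by
    have h : mat (c • x) = c • mat x := rfl
    refine ⟨fun a b hab => ?_, fun a k hk => ?_⟩
    · rw [h, Matrix.smul_apply, hx.1 a b hab, smul_zero]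
    · rw [h, Matrix.smul_apply, AddMonoidAlgebra.coeff_smul, Finsupp.smul_apply, hx.2 a k hk,
        smul_zero]
  lie_mem' {x y} hx hy := by
    have h : mat ⁅x, y⁆ = 0 := diag_bracket hx.1 hy.1
    exact ⟨fun a b _ => by rw [h]; rfl, fun a k _ => by rw [h]; rfl⟩

theorem hPlus_lie_eq_zero {n : ℕ} (x y : hPlus n) : ⁅x, y⁆ = 0 :=
  Subtype.ext (Subtype.ext (diag_bracket x.2.1 y.2.1))

/-! ### Structure of the root vectors -/

theorem el_mul_same {n : ℕ} (a b c : Fin (2 * n + 1)) (x y : ℂ) (k l : ℤ) :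
    el a b x k * el b c y l = el a c (x * y) (k + l) := by
  simp only [el, Matrix.single_mul_single_same, map_mul, LaurentPolynomial.T_add]
  congr 1
  ring

theorem el_mul_ne {n : ℕ} (a b b' c : Fin (2 * n + 1)) (x y : ℂ) (k l : ℤ) (h : b ≠ b') :
    el a b x k * el b' c y l = 0 := by
  simp [el, Matrix.single_mul_single_of_ne _ _ _ _ h]

theorem lo_ne_hi {n : ℕ} (i j : Fin n) : lo i ≠ hi j := by
  intro h; have := congrArg Fin.val h; simp only [lo, hi] at this; omega

theorem lo_ne_lo {n : ℕ} {i j : Fin n} (h : i ≠ j) : lo i ≠ lo j := by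
  intro h'; have := congrArg Fin.val h'; simp only [lo] at this; omega

theorem hi_ne_hi {n : ℕ} {i j : Fin n} (h : i ≠ j) : hi i ≠ hi j := by
  intro h'; have := congrArg Fin.val h'; simp only [hi] at this; omega

/-- The coroot of a positive root as a diagonal matrix. -/
def corootMat {n : ℕ} : PosRoot n → LoopMat n
  | .sub i j _ => el (lo i) (lo i) 1 0 - el (lo j) (lo j) 1 0 + el (hi j) (hi j) 1 0
      - el (hi i) (hi i) 1 0
  | .add i j _ => el (lo i) (lo i) 1 0 + el (lo j) (lo j) 1 0 - el (hi j) (hi j) 1 0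
      - el (hi i) (hi i) 1 0
  | .long i => el (lo i) (lo i) 1 0 - el (hi i) (hi i) 1 0

theorem sign_mul (k : ℕ) : ((-1 : ℂ) ^ k) * (-1) ^ k = 1 := by
  rw [← mul_pow]; simp

theorem mat_coroot {n : ℕ} (α : PosRoot n) : mat (coroot α) = corootMat α := by
  have h0 : mat (coroot α) = rootVec α * rootVecNeg α - rootVecNeg α * rootVec α := rfl
  rw [h0]
  cases α with
  | sub i j h =>
    have a1 := lo_ne_lo h.ne; have a2 := hi_ne_hi h.ne
    simp only [rootVec, rootVecNeg, corootMat, mul_sub, sub_mul, el_mul_same, el_mul_ne _ _ _ _ _ _ _ _ (lo_ne_hi _ _), el_mul_ne _ _ _ _ _ _ _ _ (lo_ne_hi _ _).symm,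
      sign_mul, mul_one, add_zero, sub_zero, zero_sub]
    abel
  | add i j h =>
    have a1 := lo_ne_lo h.ne; have a2 := hi_ne_hi h.ne
    simp only [rootVec, rootVecNeg, corootMat, mul_add, add_mul, el_mul_same,
      el_mul_ne _ _ _ _ _ _ _ _ a1, el_mul_ne _ _ _ _ _ _ _ _ a1.symm,
      el_mul_ne _ _ _ _ _ _ _ _ a2, el_mul_ne _ _ _ _ _ _ _ _ a2.symm,
      sign_mul, mul_one, add_zero, zero_add]
    norm_num
    abel
  | long i =>
    simp only [rootVec, rootVecNeg, corootMat, el_mul_same, mul_one]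
    norm_num

theorem lie_coroot_xPos {n : ℕ} (α : PosRoot n) : ⁅coroot α, xPos α⁆ = (2 : ℂ) • xPos α := by
  apply Subtype.ext
  change mat (coroot α) * rootVec α - rootVec α * mat (coroot α) = (2 : ℂ) • rootVec α
  rw [mat_coroot, two_smul]
  cases α with
  | sub i j h =>
    have a1 := lo_ne_lo h.ne; have a2 := hi_ne_hi h.ne
    simp only [rootVec, corootMat, mul_sub, sub_mul, mul_add, add_mul, el_mul_same,
      el_mul_ne _ _ _ _ _ _ _ _ (lo_ne_hi _ _), el_mul_ne _ _ _ _ _ _ _ _ (lo_ne_hi _ _).symm,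
      el_mul_ne _ _ _ _ _ _ _ _ a1, el_mul_ne _ _ _ _ _ _ _ _ a1.symm,
      el_mul_ne _ _ _ _ _ _ _ _ a2, el_mul_ne _ _ _ _ _ _ _ _ a2.symm,
      mul_one, one_mul, add_zero, zero_add, sub_zero, zero_sub]
    abel
  | add i j h =>
    have a1 := lo_ne_lo h.ne; have a2 := hi_ne_hi h.ne
    simp only [rootVec, corootMat, mul_sub, sub_mul, mul_add, add_mul, el_mul_same,
      el_mul_ne _ _ _ _ _ _ _ _ (lo_ne_hi _ _), el_mul_ne _ _ _ _ _ _ _ _ (lo_ne_hi _ _).symm,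
      el_mul_ne _ _ _ _ _ _ _ _ a1, el_mul_ne _ _ _ _ _ _ _ _ a1.symm,
      el_mul_ne _ _ _ _ _ _ _ _ a2, el_mul_ne _ _ _ _ _ _ _ _ a2.symm,
      mul_one, one_mul, add_zero, zero_add, sub_zero, zero_sub]
    abel
  | long i =>
    simp only [rootVec, corootMat, mul_sub, sub_mul, el_mul_same,
      el_mul_ne _ _ _ _ _ _ _ _ (lo_ne_hi _ _), el_mul_ne _ _ _ _ _ _ _ _ (lo_ne_hi _ _).symm,
      mul_one, add_zero, zero_add, sub_zero, zero_sub]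
    abel

theorem lie_coroot_xNeg {n : ℕ} (α : PosRoot n) : ⁅coroot α, xNeg α⁆ = -((2 : ℂ) • xNeg α) := by
  apply Subtype.ext
  change mat (coroot α) * rootVecNeg α - rootVecNeg α * mat (coroot α) =
    -((2 : ℂ) • rootVecNeg α)
  rw [mat_coroot, two_smul]
  cases α with
  | sub i j h =>
    have a1 := lo_ne_lo h.ne; have a2 := hi_ne_hi h.ne
    simp only [rootVecNeg, corootMat, mul_sub, sub_mul, mul_add, add_mul, el_mul_same,
      el_mul_ne _ _ _ _ _ _ _ _ (lo_ne_hi _ _), el_mul_ne _ _ _ _ _ _ _ _ (lo_ne_hi _ _).symm,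
      el_mul_ne _ _ _ _ _ _ _ _ a1, el_mul_ne _ _ _ _ _ _ _ _ a1.symm,
      el_mul_ne _ _ _ _ _ _ _ _ a2, el_mul_ne _ _ _ _ _ _ _ _ a2.symm,
      mul_one, one_mul, add_zero, zero_add, sub_zero, zero_sub]
    abel
  | add i j h =>
    have a1 := lo_ne_lo h.ne; have a2 := hi_ne_hi h.ne
    simp only [rootVecNeg, corootMat, mul_sub, sub_mul, mul_add, add_mul, el_mul_same,
      el_mul_ne _ _ _ _ _ _ _ _ (lo_ne_hi _ _), el_mul_ne _ _ _ _ _ _ _ _ (lo_ne_hi _ _).symm,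
      el_mul_ne _ _ _ _ _ _ _ _ a1, el_mul_ne _ _ _ _ _ _ _ _ a1.symm,
      el_mul_ne _ _ _ _ _ _ _ _ a2, el_mul_ne _ _ _ _ _ _ _ _ a2.symm,
      mul_one, one_mul, add_zero, zero_add, sub_zero, zero_sub]
    abel
  | long i =>
    simp only [rootVecNeg, corootMat, mul_sub, sub_mul, el_mul_same,
      el_mul_ne _ _ _ _ _ _ _ _ (lo_ne_hi _ _), el_mul_ne _ _ _ _ _ _ _ _ (lo_ne_hi _ _).symm,
      mul_one, add_zero, zero_add, sub_zero, zero_sub]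
    abel

theorem rootVecNeg_sq {n : ℕ} (α : PosRoot n) : rootVecNeg α * rootVecNeg α = 0 := by
  cases α with
  | sub i j h =>
    have a1 := lo_ne_lo h.ne; have a2 := hi_ne_hi h.ne
    simp [rootVecNeg, mul_sub, sub_mul,
      el_mul_ne _ _ _ _ _ _ _ _ (lo_ne_hi _ _), el_mul_ne _ _ _ _ _ _ _ _ (lo_ne_hi _ _).symm,
      el_mul_ne _ _ _ _ _ _ _ _ a1,
      el_mul_ne _ _ _ _ _ _ _ _ a2.symm]
  | add i j h =>
    simp [rootVecNeg, mul_add, add_mul,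
      el_mul_ne _ _ _ _ _ _ _ _ (lo_ne_hi _ _)]
  | long i =>
    simp [rootVecNeg, el_mul_ne _ _ _ _ _ _ _ _ (lo_ne_hi _ _)]

theorem el_apply_ne {n : ℕ} (a b a' b' : Fin (2 * n + 1)) (x : ℂ) (k : ℤ)
    (h : ¬ (a = a' ∧ b = b')) : el a b x k a' b' = 0 := by
  simp only [el]
  exact Matrix.single_apply_of_ne _ _ _ _ _ h

theorem xPos_mem_nPlus {n : ℕ} (α : PosRoot n) : xPos α ∈ nPlus n := by
  intro a b hab
  change rootVec α a b = 0
  cases α with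
  | sub i j h =>
    rw [rootVec, Matrix.sub_apply, el_apply_ne, el_apply_ne, sub_zero]
    · rintro ⟨rfl, rfl⟩
      simp only [hi, Fin.le_def] at hab
      have := Fin.lt_def.1 h
      omega
    · rintro ⟨rfl, rfl⟩
      simp only [lo, Fin.le_def] at hab
      have := Fin.lt_def.1 h
      omega
  | add i j h =>
    rw [rootVec, Matrix.add_apply, el_apply_ne, el_apply_ne, add_zero]
    · rintro ⟨rfl, rfl⟩
      simp only [lo, hi, Fin.le_def] at hab
      omega
    · rintro ⟨rfl, rfl⟩
      simp only [lo, hi, Fin.le_def] at hab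
      omega
  | long i =>
    rw [rootVec, el_apply_ne]
    rintro ⟨rfl, rfl⟩
    simp only [lo, hi, Fin.le_def] at hab
    omega

theorem cartan_diag {n : ℕ} {x : currentAlg n} (hx : x ∈ cartan n) :
    ∀ a b, a ≠ b → mat x a b = 0 := by
  induction hx using Submodule.span_induction with
  | mem x hx =>
    obtain ⟨α, rfl⟩ := hx
    intro a b hab
    rw [mat_coroot]
    have key : ∀ c : Fin (2 * n + 1), el c c 1 0 a b = 0 := fun c =>
      el_apply_ne _ _ _ _ _ _ (by rintro ⟨rfl, rfl⟩; exact hab rfl)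
    cases α <;> simp [corootMat, key]
  | zero => intro a b _; rfl
  | add x y _ _ hx hy =>
    intro a b hab
    have h : mat (x + y) = mat x + mat y := rfl
    rw [h, Matrix.add_apply, hx a b hab, hy a b hab, add_zero]
  | smul c x _ hx =>
    intro a b hab
    have h : mat (c • x) = c • mat x := rfl
    rw [h, Matrix.smul_apply, hx a b hab, smul_zero]

theorem lie_nPlus_hPlus {n : ℕ} {x c : currentAlg n} (hx : x ∈ nPlus n) (hc : c ∈ hPlus n) :
    ⁅x, c⁆ ∈ nPlus n := by
  intro a b hab
  change (mat x * mat c - mat c * mat x) a b = 0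
  rw [Matrix.sub_apply, Matrix.mul_apply, Matrix.mul_apply, Finset.sum_eq_zero,
    Finset.sum_eq_zero, sub_zero]
  · intro d _
    by_cases h : a = d
    · subst h; rw [hx a b hab, mul_zero]
    · rw [hc.1 a d h, zero_mul]
  · intro d _
    by_cases h : d = b
    · subst h; rw [hx a d hab, zero_mul]
    · rw [hc.1 d b h, mul_zero]

theorem lie_cartan_hPlus {n : ℕ} {x c : currentAlg n} (hx : x ∈ cartan n) (hc : c ∈ hPlus n) :
    ⁅x, c⁆ = 0 :=
  Subtype.ext (diag_bracket (cartan_diag hx) hc.1)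

/-! ### Enveloping algebras -/

theorem uea_induction {L : Type} [LieRing L] [LieAlgebra ℂ L]
    {C : UniversalEnvelopingAlgebra ℂ L → Prop}
    (h1 : ∀ r, C (algebraMap ℂ (UniversalEnvelopingAlgebra ℂ L) r))
    (h2 : ∀ x, C (UniversalEnvelopingAlgebra.ι ℂ x))
    (h3 : ∀ a b, C a → C b → C (a * b)) (h4 : ∀ a b, C a → C b → C (a + b))
    (a : UniversalEnvelopingAlgebra ℂ L) : C a := by
  let S : Subalgebra ℂ (UniversalEnvelopingAlgebra ℂ L) :=
    { carrier := {a | C a}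
      mul_mem' := fun {a b} ha hb => h3 a b ha hb
      add_mem' := fun {a b} ha hb => h4 a b ha hb
      algebraMap_mem' := h1 }
  let f : L →ₗ⁅ℂ⁆ S :=
    { toFun := fun x => ⟨UniversalEnvelopingAlgebra.ι ℂ x, h2 x⟩
      map_add' := fun x y => Subtype.ext (map_add _ x y)
      map_smul' := fun c x => Subtype.ext (map_smul _ c x)
      map_lie' := fun {x y} => Subtype.ext (LieHom.map_lie _ x y) }
  have key : S.val.comp (UniversalEnvelopingAlgebra.lift ℂ f) = AlgHom.id ℂ _ := by
    apply UniversalEnvelopingAlgebra.hom_ext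
    ext x
    change ((UniversalEnvelopingAlgebra.lift ℂ f (UniversalEnvelopingAlgebra.ι ℂ x) : S) :
      UniversalEnvelopingAlgebra ℂ L) = UniversalEnvelopingAlgebra.ι ℂ x
    rw [UniversalEnvelopingAlgebra.lift_ι_apply]
    rfl
  have h : ((UniversalEnvelopingAlgebra.lift ℂ f a : S) : UniversalEnvelopingAlgebra ℂ L) = a :=
    congrArg (fun g => g a) key
  rw [← h]
  exact (UniversalEnvelopingAlgebra.lift ℂ f a).2

theorem uea_mul_comm {L : Type} [LieRing L] [LieAlgebra ℂ L] (hL : ∀ x y : L, ⁅x, y⁆ = 0)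
    (a b : UniversalEnvelopingAlgebra ℂ L) : a * b = b * a := by
  induction a using uea_induction with
  | h1 r => exact Algebra.commutes r b
  | h2 x =>
    induction b using uea_induction with
    | h1 r => exact (Algebra.commutes r _).symm
    | h2 y =>
      have h := LieHom.map_lie (UniversalEnvelopingAlgebra.ι ℂ : L →ₗ⁅ℂ⁆ _) x y
      rw [hL, map_zero, LieRing.of_associative_ring_bracket] at h
      exact (sub_eq_zero.1 h.symm)
    | h3 a b ha hb => rw [← mul_assoc, ha, mul_assoc, hb, mul_assoc]
    | h4 a b ha hb => rw [mul_add, add_mul, ha, hb]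
  | h3 a c ha hc => rw [mul_assoc, hc, ← mul_assoc, ha, mul_assoc]
  | h4 a c ha hc => rw [mul_add, add_mul, ha, hc]

/-- The enveloping algebra `U(C𝔤)`. -/
abbrev UCur (n : ℕ) : Type := UniversalEnvelopingAlgebra ℂ (currentAlg n)

/-- The enveloping algebra `U(C𝔥_+)`. -/
abbrev UH (n : ℕ) : Type := UniversalEnvelopingAlgebra ℂ (hPlus n)

/-- `U(C𝔥_+)` is commutative since `C𝔥_+` is abelian. -/
instance instCommRingUH (n : ℕ) : CommRing (UH n) :=
  { (inferInstance : Ring (UH n)) with mul_comm := uea_mul_comm hPlus_lie_eq_zero }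

/-- The canonical map `C𝔤 → U(C𝔤)`. -/
def inc {n : ℕ} (x : currentAlg n) : UCur n := UniversalEnvelopingAlgebra.ι ℂ x

/-- The algebra map `U(C𝔥_+) → U(C𝔤)` induced by the inclusion `C𝔥_+ ⊆ C𝔤`. -/
def incH (n : ℕ) : UH n →ₐ[ℂ] UCur n :=
  UniversalEnvelopingAlgebra.lift ℂ
    ((UniversalEnvelopingAlgebra.ι ℂ : currentAlg n →ₗ⁅ℂ⁆ UCur n).comp (hPlus n).incl)

theorem incH_ι {n : ℕ} (c : hPlus n) :
    incH n (UniversalEnvelopingAlgebra.ι ℂ c) = inc (c : currentAlg n) :=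
  UniversalEnvelopingAlgebra.lift_ι_apply ℂ _ c

theorem inc_mul {n : ℕ} (x y : currentAlg n) : inc x * inc y = inc ⁅x, y⁆ + inc y * inc x := by
  have h := LieHom.map_lie (UniversalEnvelopingAlgebra.ι ℂ : currentAlg n →ₗ⁅ℂ⁆ UCur n) x y
  rw [LieRing.of_associative_ring_bracket] at h
  exact (eq_add_of_sub_eq h.symm)

/-! ### Global Weyl modules -/

/-- The defining relations of the global Weyl module `W(λ)`, as elements of `U(C𝔤)` that annihilate
the generator `w_λ`: `C𝔫^+ w_λ = 0`, `h w_λ = λ(h) w_λ` for `h ∈ 𝔥`, and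
`x_{-α}^{λ(α^∨) + 1} w_λ = 0` for `α ∈ R^+`. -/
inductive WeylRel {n : ℕ} (wt : Module.Dual ℂ (cartan n)) : UCur n → Prop
  | nPlus (x : currentAlg n) (hx : x ∈ nPlus n) : WeylRel wt (inc x)
  | cartan (h : cartan n) : WeylRel wt (inc (h : currentAlg n) - algebraMap ℂ (UCur n) (wt h))
  | xNeg (α : PosRoot n) (m : ℕ) (hm : wt (corootH α) = m) : WeylRel wt (inc (xNeg α) ^ (m + 1))

/-- The left ideal of `U(C𝔤)` generated by the defining relations of `W(λ)`. -/
def weylIdeal {n : ℕ} (wt : Module.Dual ℂ (cartan n)) : Submodule (UCur n) (UCur n) :=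
  Submodule.span (UCur n) {a | WeylRel wt a}

/-- The global Weyl module `W(λ)`: the left `U(C𝔤)`-module (that is, the `C𝔤`-module) generated by
`w_λ` subject to the defining relations. -/
def GlobalWeyl {n : ℕ} (wt : Module.Dual ℂ (cartan n)) : Type := UCur n ⧸ weylIdeal wt

section
variable {n : ℕ} (wt : Module.Dual ℂ (cartan n))

instance : AddCommGroup (GlobalWeyl wt) := inferInstanceAs (AddCommGroup (UCur n ⧸ weylIdeal wt))
instance : Module (UCur n) (GlobalWeyl wt) :=
  inferInstanceAs (Module (UCur n) (UCur n ⧸ weylIdeal wt))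
instance : Module ℂ (GlobalWeyl wt) := inferInstanceAs (Module ℂ (UCur n ⧸ weylIdeal wt))
instance : IsScalarTower ℂ (UCur n) (GlobalWeyl wt) :=
  inferInstanceAs (IsScalarTower ℂ (UCur n) (UCur n ⧸ weylIdeal wt))

/-- The quotient map `U(C𝔤) → W(λ)`, `y ↦ y w_λ`. -/
def toWeyl : UCur n →ₗ[UCur n] GlobalWeyl wt := (weylIdeal wt).mkQ

/-- The generator `w_λ`. -/
def wGen : GlobalWeyl wt := toWeyl wt 1

theorem toWeyl_surjective : Function.Surjective (toWeyl wt) := (weylIdeal wt).mkQ_surjective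

theorem toWeyl_apply (y : UCur n) : toWeyl wt y = y • wGen wt := by
  rw [wGen, ← map_smul, smul_eq_mul, mul_one]

theorem toWeyl_eq_zero {y : UCur n} : toWeyl wt y = 0 ↔ y ∈ weylIdeal wt :=
  Submodule.Quotient.mk_eq_zero _

/-- The `C𝔤`-module structure of `W(λ)`, in the form of a Lie module. -/
def weylAction : currentAlg n →ₗ⁅ℂ⁆ Module.End ℂ (GlobalWeyl wt) where
  toFun x := Module.toModuleEnd ℂ (S := UCur n) (GlobalWeyl wt) (inc x)
  map_add' x y := by
    have h : inc (x + y) = inc x + inc y := map_add _ x y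
    rw [h, map_add]
  map_smul' c x := by
    have h : inc (c • x) = c • inc x := map_smul _ c x
    rw [h]
    ext v
    simp
  map_lie' {x y} := by
    ext v
    have h : inc ⁅x, y⁆ = inc x * inc y - inc y * inc x := by rw [inc_mul]; abel
    rw [h]
    simp [LieRing.of_associative_ring_bracket, sub_smul, mul_smul]

instance : LieRingModule (currentAlg n) (GlobalWeyl wt) :=
  LieRingModule.compLieHom (GlobalWeyl wt) (weylAction wt)

instance : LieModule ℂ (currentAlg n) (GlobalWeyl wt) :=
  LieModule.compLieHom (GlobalWeyl wt) (weylAction wt)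

theorem lie_eq_inc_smul (x : currentAlg n) (v : GlobalWeyl wt) : ⁅x, v⁆ = inc x • v := rfl

theorem rel_wGen {a : UCur n} (ha : WeylRel wt a) : a • wGen wt = 0 := by
  rw [← toWeyl_apply, toWeyl_eq_zero]
  exact Submodule.subset_span ha

/-- A vector of `W(λ)` is a highest weight vector of weight `λ` if it is annihilated by `C𝔫^+` and
`𝔥` acts on it through `λ`. -/
def IsHighest (v : GlobalWeyl wt) : Prop :=
  (∀ x ∈ nPlus n, inc x • v = 0) ∧ ∀ h : cartan n, inc (h : currentAlg n) • v = wt h • v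

theorem isHighest_wGen : IsHighest wt (wGen wt) := by
  refine ⟨fun x hx => rel_wGen wt (.nPlus x hx), fun h => ?_⟩
  have := rel_wGen wt (.cartan h)
  rwa [sub_smul, sub_eq_zero, algebraMap_smul] at this

theorem isHighest_incH (u : UH n) : ∀ v, IsHighest wt v → IsHighest wt (incH n u • v) := by
  induction u using uea_induction with
  | h1 r =>
    intro v hv
    rw [AlgHom.commutes, algebraMap_smul]
    refine ⟨fun x hx => ?_, fun h => ?_⟩
    · rw [smul_algebra_smul_comm, hv.1 x hx, smul_zero]
    · rw [smul_algebra_smul_comm, hv.2 h, smul_comm]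
  | h2 c =>
    intro v hv
    rw [incH_ι]
    refine ⟨fun x hx => ?_, fun h => ?_⟩
    · rw [← mul_smul, inc_mul, add_smul, mul_smul, hv.1 x hx,
        hv.1 _ (lie_nPlus_hPlus hx c.2), smul_zero, add_zero]
    · have h0 : inc (0 : currentAlg n) = 0 := map_zero _
      rw [← mul_smul, inc_mul, lie_cartan_hPlus h.2 c.2, h0, zero_add, mul_smul, hv.2 h,
        smul_algebra_smul_comm]
  | h3 a b ha hb =>
    intro v hv
    rw [map_mul, mul_smul]
    exact ha _ (hb v hv)
  | h4 a b ha hb =>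
    intro v hv
    have h1 := ha v hv
    have h2 := hb v hv
    rw [map_add, add_smul]
    refine ⟨fun x hx => ?_, fun h => ?_⟩
    · rw [smul_add, h1.1 x hx, h2.1 x hx, add_zero]
    · rw [smul_add, h1.2 h, h2.2 h, smul_add]

theorem toEnd_pow_eq (x : currentAlg n) (k : ℕ) (v : GlobalWeyl wt) :
    (LieModule.toEnd ℂ (currentAlg n) (GlobalWeyl wt) x ^ k) v = inc x ^ k • v := by
  induction k with
  | zero => simp
  | succ k ih =>
    rw [pow_succ', Module.End.mul_apply, ih, pow_succ', mul_smul, LieModule.toEnd_apply_apply,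
      lie_eq_inc_smul]

theorem ad_xNeg_nilpotent (α : PosRoot n) : IsNilpotent (LieAlgebra.ad ℂ (currentAlg n) (xNeg α)) :=
  LieAlgebra.isNilpotent_ad_of_isNilpotent (L := currentAlg n) (x := xNeg α)
    ⟨2, by rw [pow_two]; exact rootVecNeg_sq α⟩

theorem xNeg_locally_nilpotent (α : PosRoot n) (m : ℕ) (hm : wt (corootH α) = m)
    (v : GlobalWeyl wt) : ∃ k : ℕ, inc (xNeg α) ^ k • v = 0 := by
  suffices h : v ∈ (LieModule.toEnd ℂ (currentAlg n) (GlobalWeyl wt)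
      (xNeg α)).maxGenEigenspace 0 by
    rw [Module.End.mem_maxGenEigenspace] at h
    obtain ⟨k, hk⟩ := h
    refine ⟨k, ?_⟩
    rwa [zero_smul, sub_zero, toEnd_pow_eq] at hk
  have hw : wGen wt ∈ (LieModule.toEnd ℂ (currentAlg n) (GlobalWeyl wt)
      (xNeg α)).maxGenEigenspace 0 := by
    rw [Module.End.mem_maxGenEigenspace]
    refine ⟨m + 1, ?_⟩
    rw [zero_smul, sub_zero, toEnd_pow_eq]
    exact rel_wGen wt (.xNeg α m hm)
  have had : ∀ y : currentAlg n,
      y ∈ (LieModule.toEnd ℂ (currentAlg n) (currentAlg n) (xNeg α)).maxGenEigenspace 0 := by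
    intro y
    rw [Module.End.mem_maxGenEigenspace]
    obtain ⟨k, hk⟩ := ad_xNeg_nilpotent α
    refine ⟨k, ?_⟩
    rw [zero_smul, sub_zero]
    exact congrArg (fun g => g y) hk
  obtain ⟨y, rfl⟩ := toWeyl_surjective wt v
  rw [toWeyl_apply]
  generalize wGen wt = w at hw
  induction y using uea_induction generalizing w with
  | h1 r => rw [algebraMap_smul]; exact Submodule.smul_mem _ _ hw
  | h2 x =>
    have := LieModule.lie_mem_maxGenEigenspace_toEnd (had x) hw
    rw [add_zero] at this
    exact this
  | h3 a b ha hb => rw [mul_smul]; exact ha _ (hb _ hw)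
  | h4 a b ha hb => rw [add_smul]; exact Submodule.add_mem _ (ha _ hw) (hb _ hw)

theorem xNeg_pow_highest (α : PosRoot n) (m : ℕ) (hm : wt (corootH α) = m)
    {v : GlobalWeyl wt} (hv : IsHighest wt v) : inc (xNeg α) ^ (m + 1) • v = 0 := by
  by_cases hv0 : v = 0
  · rw [hv0, smul_zero]
  by_cases hh : coroot α = 0
  · have h1 := lie_coroot_xNeg α
    rw [hh, zero_lie, eq_comm, neg_eq_zero, smul_eq_zero_iff_right two_ne_zero] at h1
    have h0 : inc (0 : currentAlg n) = 0 := map_zero _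
    rw [h1, h0, zero_pow m.succ_ne_zero, zero_smul]
  have t : IsSl2Triple (coroot α) (xPos α) (xNeg α) :=
    { h_ne_zero := hh
      lie_e_f := rfl
      lie_h_e_nsmul := by rw [lie_coroot_xPos, two_smul, two_nsmul]
      lie_h_f_nsmul := by rw [lie_coroot_xNeg, two_smul, two_nsmul] }
  have P : t.HasPrimitiveVectorWith v (m : ℂ) :=
    { ne_zero := hv0
      lie_h := by rw [lie_eq_inc_smul, ← hm]; exact hv.2 (corootH α)
      lie_e := hv.1 _ (xPos_mem_nPlus α) }
  obtain ⟨k, hk1, hk2⟩ := Nat.exists_not_and_succ_of_not_zero_of_exists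
    (p := fun k => inc (xNeg α) ^ k • v = 0) (by simpa using hv0)
    (xNeg_locally_nilpotent wt α m hm v)
  have h := P.lie_e_pow_succ_toEnd_f k
  rw [toEnd_pow_eq, toEnd_pow_eq, hk2, lie_zero, eq_comm, smul_eq_zero_iff_left hk1, mul_eq_zero,
    sub_eq_zero] at h
  have hmk : m = k := by
    have := h.resolve_left (Nat.cast_add_one_ne_zero k)
    exact_mod_cast this
  rw [hmk]
  exact hk2

/-! ### The right action of `U(C𝔥_+)`, the algebra `A_λ` and local Weyl modules -/

/-- The well-definedness of the right action: right multiplication by `u ∈ U(C𝔥_+)` preserves the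
left ideal of relations. -/
theorem weylIdeal_mul_mem (u : UH n) {y : UCur n} (hy : y ∈ weylIdeal wt) :
    y * incH n u ∈ weylIdeal wt := by
  have hu := isHighest_incH wt u _ (isHighest_wGen wt)
  rw [← toWeyl_eq_zero, toWeyl_apply, mul_smul]
  refine Submodule.span_induction (p := fun y _ => y • incH n u • wGen wt = 0) ?_ ?_ ?_ ?_ hy
  · rintro a (⟨x, hx⟩ | ⟨h⟩ | ⟨α, m, hm⟩)
    · exact hu.1 x hx
    · rw [sub_smul, hu.2 h, algebraMap_smul, sub_self]
    · exact xNeg_pow_highest wt α m hm hu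
  · exact zero_smul _ _
  · intro a b _ _ ha hb
    rw [add_smul, ha, hb, add_zero]
  · intro c a _ ha
    rw [smul_eq_mul, mul_smul, ha, smul_zero]

/-- The right action of `u ∈ U(C𝔥_+)` on `W(λ)`: the `C𝔤`-linear map with
`(y w_λ) u = y u w_λ` for all `y ∈ U(C𝔤)`. -/
def rightAct (u : UH n) : GlobalWeyl wt →ₗ[UCur n] GlobalWeyl wt :=
  (weylIdeal wt).mapQ (weylIdeal wt) (LinearMap.toSpanSingleton (UCur n) (UCur n) (incH n u))
    (fun _ hy => weylIdeal_mul_mem wt u hy)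

theorem rightAct_toWeyl (u : UH n) (y : UCur n) :
    rightAct wt u (toWeyl wt y) = toWeyl wt (y * incH n u) := rfl

/-- `W(λ)` as a right `U(C𝔥_+)`-module; since the ring is commutative, right modules are the same
as modules. -/
instance : Module (UH n) (GlobalWeyl wt) where
  smul u v := rightAct wt u v
  one_smul v := by
    obtain ⟨y, rfl⟩ := toWeyl_surjective wt v
    change rightAct wt 1 _ = _
    rw [rightAct_toWeyl, map_one, mul_one]
  mul_smul a b v := by
    obtain ⟨y, rfl⟩ := toWeyl_surjective wt v
    change rightAct wt (a * b) _ = rightAct wt a (rightAct wt b _)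
    rw [rightAct_toWeyl, rightAct_toWeyl, rightAct_toWeyl, mul_comm a b,
      map_mul (incH n), mul_assoc]
  smul_zero u := map_zero _
  smul_add u v w := map_add _ v w
  add_smul a b v := by
    obtain ⟨y, rfl⟩ := toWeyl_surjective wt v
    change rightAct wt (a + b) _ = rightAct wt a _ + rightAct wt b _
    rw [rightAct_toWeyl, rightAct_toWeyl, rightAct_toWeyl, map_add, mul_add, map_add]
  zero_smul v := by
    obtain ⟨y, rfl⟩ := toWeyl_surjective wt v
    change rightAct wt 0 _ = 0
    rw [rightAct_toWeyl, map_zero, mul_zero, map_zero]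

theorem uh_smul_toWeyl (u : UH n) (y : UCur n) :
    u • toWeyl wt y = toWeyl wt (y * incH n u) := rfl

/-- `Ann(w_λ) = {u ∈ U(C𝔥_+) : w_λ u = 0}`. -/
def annGen : Ideal (UH n) := Ideal.torsionOf (UH n) (GlobalWeyl wt) (wGen wt)

/-- The algebra `A_λ = U(C𝔥_+) / Ann(w_λ)`. -/
def WeylAlg : Type := UH n ⧸ annGen wt

instance : CommRing (WeylAlg wt) := inferInstanceAs (CommRing (UH n ⧸ annGen wt))
instance : Algebra (UH n) (WeylAlg wt) := inferInstanceAs (Algebra (UH n) (UH n ⧸ annGen wt))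

theorem isTorsionBySet_annGen : Module.IsTorsionBySet (UH n) (GlobalWeyl wt) (annGen wt) := by
  rintro v ⟨u, hu⟩
  obtain ⟨y, rfl⟩ := toWeyl_surjective wt v
  have h : u • wGen wt = 0 := hu
  rw [wGen, uh_smul_toWeyl, one_mul, toWeyl_apply] at h
  change u • toWeyl wt y = 0
  rw [uh_smul_toWeyl, toWeyl_apply, mul_smul, h, smul_zero]

/-- `W(λ)` as a (right) `A_λ`-module. -/
instance : Module (WeylAlg wt) (GlobalWeyl wt) := (isTorsionBySet_annGen wt).module

theorem algebraMap_smul_weyl (u : UH n) (v : GlobalWeyl wt) :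
    algebraMap (UH n) (WeylAlg wt) u • v = u • v := rfl

/-- The left action of `U(C𝔤)` commutes with the right action of `A_λ`. -/
instance : SMulCommClass (WeylAlg wt) (UCur n) (GlobalWeyl wt) where
  smul_comm a y v := by
    obtain ⟨u, rfl⟩ := Ideal.Quotient.mk_surjective a
    exact map_smul (rightAct wt u) y v

instance : SMulCommClass (WeylAlg wt) ℂ (GlobalWeyl wt) where
  smul_comm a c v := by
    rw [← algebraMap_smul (UCur n) c v, smul_comm, algebraMap_smul]

/-- The local Weyl module `W(λ, I) = W(λ) ⊗_{A_λ} A_λ / I`. -/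
abbrev LocalWeyl (I : Ideal (WeylAlg wt)) : Type := GlobalWeyl wt ⊗[WeylAlg wt] (WeylAlg wt ⧸ I)

end

end HyperspecialA

namespace HyperspecialA

/-! ### Spanning vectors of the twisted algebra -/

/-! Write `σ` for the involution `E_{a,b} t^k ↦ -sgn a · sgn b · (-1)^k E_{b',a'} t^k`, where `a'`
is the mirror image of `a`. The algebra `C𝔤` is the trace zero part of its fixed points in
non-negative degree, where `E_{a,b} t^k` has degree `2k - idxDeg a + idxDeg b`. This gives explicit
spanning vectors, homogeneous for the triangular decomposition (`mem_span_basisMat`, `basisMat_mem`,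
`span_basisElt`).

The first half of the argument shows that `C𝔫^- w_λ` lies in the `U(C𝔥_+)`-span of finitely many
vectors `x w_λ`. Each long root gives a copy of `sl₂ ⊗ ℂ[u]` with `u = t²`. Applying `(x⁺ ⊗ u)^N` to
`(x⁻)^{N+1} w_λ = 0` yields `(x⁻ ⊗ u^N) w_λ` up to a nonzero constant and lower terms
(`garland_finite`, `act_longNeg_mem`). No such identity is needed for the other roots: up to the
mirror symmetry, every other lower triangular vector is a bracket of an upper triangular one with
`x⁻ ⊗ u^m`, and the former kills `w_λ` (`act_lo_mem`, `exists_lowerSpan`).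

The second half bounds the length of monomials. A commutator induction, replacing PBW, shows that
monomials in a finite set of lower triangular vectors span `W(λ)` over `U(C𝔥_+)` (`act_filt`,
`exists_mem_filt`). Every factor lowers the height of the weight by at least one and does not raise
its coordinate sum. The relations for the long roots allow negative coordinates of a weight to be
made positive by `sl₂`-theory, so the sum of their absolute values is bounded
(`sum_abs_le_of_isWt`). Heights are therefore bounded below, long monomials contribute nothing new,
and `finite_uh` follows.

For local Weyl modules it remains to see that `A_λ / I` is `ℂ`. As `U(C𝔥_+)` has countable dimension
over the uncountable algebraically closed field `ℂ`, no finite generation of `A_λ` is needed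
(`exists_sub_mem_of_isMaximal`). -/

/-- The signs defining the twisting involution of the loop algebra. -/
def sgn {n : ℕ} (a : Fin (2 * n + 1)) : ℂ := if a.val = n then 1 else (-1) ^ a.val

theorem sgn_mul_self {n : ℕ} (a : Fin (2 * n + 1)) : sgn a * sgn a = 1 := by
  unfold sgn
  split_ifs
  · simp
  · exact sign_mul _

theorem sgn_rev {n : ℕ} (a : Fin (2 * n + 1)) : sgn a.rev = sgn a := by
  unfold sgn
  have h : a.rev.val + a.val = 2 * n := by rw [Fin.val_rev]; omega
  by_cases h1 : a.val = n
  · rw [if_pos h1, if_pos (by omega)]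
  · rw [if_neg h1, if_neg (by omega)]
    have h2 := sign_mul a.val
    calc (-1 : ℂ) ^ a.rev.val = (-1) ^ a.rev.val * ((-1) ^ a.val * (-1) ^ a.val) := by
          rw [h2, mul_one]
      _ = (-1) ^ a.val := by rw [← mul_assoc, ← pow_add, h, pow_mul]; simp

theorem zsign_mul_self (k : ℤ) : ((-1 : ℂ) ^ k) * (-1) ^ k = 1 := by
  rw [← mul_zpow]; simp

theorem zsign_add (k l : ℤ) : ((-1 : ℂ) ^ (k + l)) = (-1) ^ k * (-1) ^ l :=
  zpow_add₀ (by norm_num) k l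

theorem el_eq_smul {n : ℕ} (a b : Fin (2 * n + 1)) (c : ℂ) (k : ℤ) :
    el a b c k = c • el a b 1 k := by
  simp only [el, Matrix.smul_single, map_one, one_mul]
  congr 1
  rw [LaurentPolynomial.smul_eq_C_mul]

theorem el_mul {n : ℕ} (a b c d : Fin (2 * n + 1)) (k l : ℤ) :
    el a b 1 k * el c d 1 l = if b = c then el a d 1 (k + l) else 0 := by
  split_ifs with h
  · subst h; rw [el_mul_same, mul_one]
  · exact el_mul_ne _ _ _ _ _ _ _ _ h

/-- The projection of `2 E_{a,b} ⊗ t^k` to the fixed points of the twisting involution. -/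
def twist {n : ℕ} (a b : Fin (2 * n + 1)) (k : ℤ) : LoopMat n :=
  el a b 1 k - (sgn a * sgn b * (-1) ^ k) • el b.rev a.rev 1 k

/-- A matrix unit and its image under `σ` have the same projection to the fixed points, so only half
of the index pairs matter. -/
theorem twist_rev {n : ℕ} (a b : Fin (2 * n + 1)) (k : ℤ) :
    twist b.rev a.rev k = -(sgn a * sgn b * (-1) ^ k) • twist a b k := by
  simp only [twist, sgn_rev, Fin.rev_rev]
  have h1 := sgn_mul_self a
  have h2 := sgn_mul_self b
  have h3 := zsign_mul_self k
  match_scalars <;> grind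

/-- Since `-σ` reverses products, the left side is `xy + σ(xy)` for the two matrix units `x`, `y`.
-/
theorem el_mul_sub_mul {n : ℕ} (a b c d : Fin (2 * n + 1)) (k l : ℤ) :
    el a b 1 k * el c d 1 l - ((sgn c * sgn d * (-1) ^ l) * (sgn a * sgn b * (-1) ^ k)) •
      (el d.rev c.rev 1 l * el b.rev a.rev 1 k) = if b = c then twist a d (k + l) else 0 := by
  rw [el_mul, el_mul]
  by_cases h : b = c
  · subst h
    rw [if_pos rfl, if_pos rfl, if_pos rfl, twist, zsign_add, add_comm l k]
    congr 2
    linear_combination (sgn a * sgn d * (-1) ^ k * (-1) ^ l) * sgn_mul_self b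
  · rw [if_neg h, if_neg h, if_neg (fun h' => h (Fin.rev_inj.1 h').symm), smul_zero, sub_zero]

/-- As `σ` is an involutive Lie automorphism, `[x + σx, y + σy]` is the projection of `[x, y] + [x,
σy]`; its four products are the four terms. -/
theorem lie_twist {n : ℕ} (a b c d : Fin (2 * n + 1)) (k l : ℤ) :
    ⁅twist a b k, twist c d l⁆ =
      (if b = c then twist a d (k + l) else 0) - (if d = a then twist c b (k + l) else 0)
      - (sgn c * sgn d * (-1) ^ l) • ((if b = d.rev then twist a c.rev (k + l) else 0)
        - (if c.rev = a then twist d.rev b (k + l) else 0)) := by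
  have t2 := el_mul_sub_mul c d a b l k
  have t4 := el_mul_sub_mul d.rev c.rev a b l k
  rw [add_comm l k] at t2 t4
  rw [← el_mul_sub_mul a b c d, ← el_mul_sub_mul a b d.rev c.rev, ← t2, ← t4,
    LieRing.of_associative_ring_bracket]
  simp only [twist, mul_sub, sub_mul, smul_mul_assoc, mul_smul_comm, sgn_rev, Fin.rev_rev]
  have hc := sgn_mul_self c
  have hd := sgn_mul_self d
  have hl := zsign_mul_self l
  generalize (-1 : ℂ) ^ l = v at *
  generalize (-1 : ℂ) ^ k = u at *
  generalize sgn a = x at *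
  generalize sgn b = y at *
  generalize sgn c = z at *
  generalize sgn d = w at *
  match_scalars <;> grind

theorem rev_lo {n : ℕ} (i : Fin n) : (lo i).rev = hi i := by
  apply Fin.ext; simp only [lo, hi, Fin.val_rev]; omega

theorem rev_hi {n : ℕ} (i : Fin n) : (hi i).rev = lo i := by
  rw [← rev_lo, Fin.rev_rev]

theorem rev_mid (n : ℕ) : (mid n).rev = mid n := by
  apply Fin.ext; simp only [mid, Fin.val_rev]; omega

theorem sgn_lo {n : ℕ} (i : Fin n) : sgn (lo i) = (-1) ^ i.val := by
  rw [sgn, if_neg]; · rfl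
  simp only [lo]; omega

theorem sgn_hi {n : ℕ} (i : Fin n) : sgn (hi i) = (-1) ^ i.val := by
  rw [← rev_lo, sgn_rev, sgn_lo]

theorem sgn_mid (n : ℕ) : sgn (mid n) = 1 := if_pos rfl

theorem sgn_zero (n : ℕ) : sgn (0 : Fin (2 * n + 1)) = 1 := by
  simp [sgn]

theorem lo_ne_mid {n : ℕ} (i : Fin n) : lo i ≠ mid n := by
  intro h; have := congrArg Fin.val h; simp only [lo, mid] at this; omega

theorem hi_ne_mid {n : ℕ} (i : Fin n) : hi i ≠ mid n := by
  intro h; have := congrArg Fin.val h; simp only [hi, mid] at this; omega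

theorem index_cases {n : ℕ} (a : Fin (2 * n + 1)) :
    (∃ i, a = lo i) ∨ a = mid n ∨ ∃ i, a = hi i := by
  rcases lt_trichotomy a.val n with h | h | h
  · exact Or.inl ⟨⟨a, h⟩, rfl⟩
  · exact Or.inr (Or.inl (Fin.ext h))
  · refine Or.inr (Or.inr ⟨⟨2 * n - a, by omega⟩, Fin.ext ?_⟩)
    simp only [hi]; omega

/-- The degrees of the matrix indices defining the hyperspecial grading. -/
def idxDeg {n : ℕ} (a : Fin (2 * n + 1)) : ℤ := if a.val < n then 2 else if a.val = n then 1 else 0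

theorem idxDeg_lo {n : ℕ} (i : Fin n) : idxDeg (lo i) = 2 := if_pos i.2

theorem idxDeg_mid (n : ℕ) : idxDeg (mid n) = 1 := by simp [idxDeg, mid]

theorem idxDeg_hi {n : ℕ} (i : Fin n) : idxDeg (hi i) = 0 := by
  have h : (hi i).val = 2 * n - i := rfl
  rw [idxDeg, if_neg (by omega), if_neg (by omega)]

theorem idxDeg_rev {n : ℕ} (a : Fin (2 * n + 1)) : idxDeg a.rev = 2 - idxDeg a := by
  rcases index_cases a with ⟨i, rfl⟩ | rfl | ⟨i, rfl⟩
  · rw [rev_lo, idxDeg_lo, idxDeg_hi]; rfl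
  · rw [rev_mid, idxDeg_mid]; rfl
  · rw [rev_hi, idxDeg_lo, idxDeg_hi]; rfl

theorem idxDeg_antitone {n : ℕ} {a b : Fin (2 * n + 1)} (h : a ≤ b) : idxDeg b ≤ idxDeg a := by
  rw [Fin.le_def] at h
  unfold idxDeg
  split_ifs <;> omega

/-- `E_{a,b} ⊗ t^k` has non-negative degree for the hyperspecial grading. -/
def Nonneg {n : ℕ} (a b : Fin (2 * n + 1)) (k : ℤ) : Prop := idxDeg a - idxDeg b ≤ 2 * k

theorem Nonneg.rev {n : ℕ} {a b : Fin (2 * n + 1)} {k : ℤ} (h : Nonneg a b k) :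
    Nonneg b.rev a.rev k := by
  unfold Nonneg at *; rw [idxDeg_rev, idxDeg_rev]; omega

theorem twist_lo_lo {n : ℕ} (i j : Fin n) :
    twist (lo i) (lo j) 0 = el (lo i) (lo j) 1 0 - el (hi j) (hi i) ((-1) ^ (i.val + j.val)) 0 := by
  rw [twist, el_eq_smul (hi j), rev_lo, rev_lo, sgn_lo, sgn_lo, pow_add]
  simp

theorem twist_lo_hi {n : ℕ} (i j : Fin n) :
    twist (lo i) (hi j) 1 = el (lo i) (hi j) 1 1 + el (lo j) (hi i) ((-1) ^ (i.val + j.val)) 1 := by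
  rw [twist, el_eq_smul (lo j), rev_lo, rev_hi, sgn_lo, sgn_hi, pow_add]
  simp

theorem twist_hi_lo {n : ℕ} (i j : Fin n) :
    twist (hi j) (lo i) (-1) =
      el (hi j) (lo i) 1 (-1) + el (hi i) (lo j) ((-1) ^ (i.val + j.val)) (-1) := by
  rw [twist, el_eq_smul (hi i), rev_lo, rev_hi, sgn_lo, sgn_hi, pow_add]
  simp [mul_comm]

theorem rootVec_sub {n : ℕ} {i j : Fin n} (h : i < j) :
    rootVec (.sub i j h) = twist (lo i) (lo j) 0 := (twist_lo_lo i j).symm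

theorem rootVec_add {n : ℕ} {i j : Fin n} (h : i < j) :
    rootVec (.add i j h) = twist (lo i) (hi j) 1 := (twist_lo_hi i j).symm

theorem rootVec_long {n : ℕ} (i : Fin n) :
    rootVec (.long i) = (2⁻¹ : ℂ) • twist (lo i) (hi i) 1 := by
  rw [twist_lo_hi, pow_add, sign_mul, ← two_smul ℂ, smul_smul]
  norm_num [rootVec]

theorem rootVecNeg_sub {n : ℕ} {i j : Fin n} (h : i < j) :
    rootVecNeg (.sub i j h) = twist (lo j) (lo i) 0 := by
  rw [twist_lo_lo, add_comm j.val]; rfl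

theorem rootVecNeg_add {n : ℕ} {i j : Fin n} (h : i < j) :
    rootVecNeg (.add i j h) = twist (hi j) (lo i) (-1) := (twist_hi_lo i j).symm

theorem rootVecNeg_long {n : ℕ} (i : Fin n) :
    rootVecNeg (.long i) = (2⁻¹ : ℂ) • twist (hi i) (lo i) (-1) := by
  rw [twist_hi_lo, pow_add, sign_mul, ← two_smul ℂ, smul_smul]
  norm_num [rootVecNeg]

theorem affineVec_eq (n : ℕ) : affineVec n = twist (mid n) 0 0 := by
  rw [twist, rev_mid, sgn_mid, sgn_zero, Fin.rev_zero]
  simp [affineVec]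

/-- The span of the elements `twist a b k` of non-negative degree. -/
def twistSpan (n : ℕ) : Submodule ℂ (LoopMat n) :=
  Submodule.span ℂ {x | ∃ a b k, Nonneg a b k ∧ x = twist a b k}

theorem twist_mem_twistSpan {n : ℕ} {a b : Fin (2 * n + 1)} {k : ℤ} (h : Nonneg a b k) :
    twist a b k ∈ twistSpan n := Submodule.subset_span ⟨a, b, k, h, rfl⟩

theorem lie_mem_twistSpan {n : ℕ} {x y : LoopMat n} (hx : x ∈ twistSpan n)
    (hy : y ∈ twistSpan n) : ⁅x, y⁆ ∈ twistSpan n := by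
  induction hx, hy using Submodule.span_induction₂ with
  | mem_mem x y hx hy =>
    obtain ⟨a, b, k, h1, rfl⟩ := hx
    obtain ⟨c, d, l, h2, rfl⟩ := hy
    have hd := idxDeg_rev d
    have hc := idxDeg_rev c
    unfold Nonneg at h1 h2
    rw [lie_twist]
    refine sub_mem (sub_mem ?_ ?_) (Submodule.smul_mem _ _ (sub_mem ?_ ?_)) <;> split_ifs with h <;>
      first
        | exact zero_mem _
        | (apply twist_mem_twistSpan; unfold Nonneg; subst h; omega)
  | zero_left y _ => rw [zero_lie]; exact zero_mem _
  | zero_right x _ => rw [lie_zero]; exact zero_mem _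
  | add_left x y z _ _ _ h1 h2 => rw [add_lie]; exact add_mem h1 h2
  | add_right x y z _ _ _ h1 h2 => rw [lie_add]; exact add_mem h1 h2
  | smul_left r x y _ _ h => rw [smul_lie]; exact Submodule.smul_mem _ _ h
  | smul_right r x y _ _ h => rw [lie_smul]; exact Submodule.smul_mem _ _ h

/-! ### The trace zero part, and spanning vectors that contain `C𝔤` in their span -/

theorem trace_el {n : ℕ} (a b : Fin (2 * n + 1)) (k : ℤ) :
    Matrix.trace (el a b 1 k) = if a = b then LaurentPolynomial.T k else 0 := by
  rw [el]
  split_ifs with h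
  · subst h; simp [Matrix.trace_single_eq_same]
  · exact Matrix.trace_single_eq_of_ne _ _ _ h

theorem trace_twist {n : ℕ} (a b : Fin (2 * n + 1)) (k : ℤ) :
    Matrix.trace (twist a b k) =
      if a = b then (1 - (-1 : ℂ) ^ k) • LaurentPolynomial.T k else 0 := by
  rw [twist, Matrix.trace_sub, Matrix.trace_smul, trace_el, trace_el]
  by_cases h : a = b
  · subst h; rw [if_pos rfl, if_pos rfl, if_pos rfl, sgn_mul_self, one_mul, sub_smul, one_smul]
  · rw [if_neg h, if_neg (fun h' => h (Fin.rev_inj.1 h').symm), if_neg h, smul_zero, sub_zero]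

/-- The Lie algebra of trace zero elements of `twistSpan`. -/
def twistAlg (n : ℕ) : LieSubalgebra ℂ (LoopMat n) where
  carrier := {x | x ∈ twistSpan n ∧ Matrix.trace x = 0}
  add_mem' hx hy := ⟨add_mem hx.1 hy.1, by rw [Matrix.trace_add, hx.2, hy.2, add_zero]⟩
  zero_mem' := ⟨zero_mem _, Matrix.trace_zero _ _⟩
  smul_mem' c x hx := ⟨Submodule.smul_mem _ c hx.1, by rw [Matrix.trace_smul, hx.2, smul_zero]⟩
  lie_mem' {x y} hx hy := ⟨lie_mem_twistSpan hx.1 hy.1, by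
    rw [LieRing.of_associative_ring_bracket, Matrix.trace_sub, Matrix.trace_mul_comm, sub_self]⟩

theorem twist_mem_twistAlg {n : ℕ} {a b : Fin (2 * n + 1)} {k : ℤ} (h : Nonneg a b k)
    (hab : a ≠ b) : twist a b k ∈ twistAlg n :=
  ⟨twist_mem_twistSpan h, by rw [trace_twist, if_neg hab]⟩

/-- Only generators have to be checked: root vectors of `𝔤` have degree zero, and `x_0^+` has
non-negative degree. -/
theorem currentAlg_le_twistAlg (n : ℕ) : currentAlg n ≤ twistAlg n := by
  rw [currentAlg, LieSubalgebra.lieSpan_le, Set.union_subset_iff]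
  have h0 : ∀ i j : Fin n, Nonneg (lo i) (lo j) 0 := fun i j => by
    unfold Nonneg; rw [idxDeg_lo, idxDeg_lo]; norm_num
  have h1 : ∀ i j : Fin n, Nonneg (lo i) (hi j) 1 := fun i j => by
    unfold Nonneg; rw [idxDeg_lo, idxDeg_hi]; norm_num
  have h2 : ∀ i j : Fin n, Nonneg (hi i) (lo j) (-1) := fun i j => by
    unfold Nonneg; rw [idxDeg_lo, idxDeg_hi]; norm_num
  constructor
  · change finiteAlg n ≤ twistAlg n
    rw [finiteAlg, LieSubalgebra.lieSpan_le, Set.union_subset_iff]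
    constructor
    · rintro _ ⟨α, rfl⟩
      cases α with
      | sub i j h => rw [rootVec_sub]; exact twist_mem_twistAlg (h0 _ _) (lo_ne_lo h.ne)
      | add i j h => rw [rootVec_add]; exact twist_mem_twistAlg (h1 _ _) (lo_ne_hi _ _)
      | long i =>
        rw [rootVec_long]
        exact (twistAlg n).smul_mem _ (twist_mem_twistAlg (h1 _ _) (lo_ne_hi _ _))
    · rintro _ ⟨α, rfl⟩
      cases α with
      | sub i j h => rw [rootVecNeg_sub]; exact twist_mem_twistAlg (h0 _ _) (lo_ne_lo h.ne')
      | add i j h => rw [rootVecNeg_add]; exact twist_mem_twistAlg (h2 _ _) (lo_ne_hi _ _).symm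
      | long i =>
        rw [rootVecNeg_long]
        exact (twistAlg n).smul_mem _ (twist_mem_twistAlg (h2 _ _) (lo_ne_hi _ _).symm)
  · rintro _ rfl
    refine ⟨?_, ?_⟩
    · rw [affineVec_eq]
      apply twist_mem_twistSpan
      unfold Nonneg
      have := idxDeg_antitone (Fin.zero_le (mid n))
      omega
    · rw [affineVec_eq, trace_twist]
      -- The middle index is `0` only for `n = 0`, and then the factor `1 - (-1)^0` vanishes.
      split_ifs <;> simp

/-- The trace zero modification of `twist a b k`. -/
def basisMat {n : ℕ} (a b : Fin (2 * n + 1)) (k : ℤ) : LoopMat n :=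
  twist a b k - if a = b then twist (mid n) (mid n) k else 0

theorem basisMat_of_ne {n : ℕ} {a b : Fin (2 * n + 1)} (h : a ≠ b) (k : ℤ) :
    basisMat a b k = twist a b k := by rw [basisMat, if_neg h, sub_zero]

theorem twist_mid (n : ℕ) (k : ℤ) :
    twist (mid n) (mid n) k = (1 - (-1 : ℂ) ^ k) • el (mid n) (mid n) 1 k := by
  rw [twist, rev_mid, sgn_mid, sub_smul, one_smul, one_mul, one_mul]

theorem basisMat_eq {n : ℕ} (a b : Fin (2 * n + 1)) (k : ℤ) :
    basisMat a b k =
      twist a b k - Matrix.single (mid n) (mid n) (Matrix.trace (twist a b k)) := by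
  rw [basisMat, trace_twist]
  split_ifs
  · rw [twist_mid, el, ← Matrix.smul_single]; simp
  · simp

/-- The map that subtracts the trace at the middle diagonal entry fixes trace zero matrices and
sends `twist a b k` to `basisMat a b k`. -/
theorem mem_span_basisMat {n : ℕ} {x : LoopMat n} (hx : x ∈ currentAlg n) :
    x ∈ Submodule.span ℂ {x : LoopMat n | ∃ a b k, Nonneg a b k ∧ x = basisMat a b k} := by
  obtain ⟨h1, h2⟩ := currentAlg_le_twistAlg n hx
  have key : ∀ y ∈ twistSpan n, y - Matrix.single (mid n) (mid n) (Matrix.trace y) ∈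
      Submodule.span ℂ {x : LoopMat n | ∃ a b k, Nonneg a b k ∧ x = basisMat a b k} := by
    intro y hy
    induction hy using Submodule.span_induction with
    | mem y hy =>
      obtain ⟨a, b, k, h, rfl⟩ := hy
      exact Submodule.subset_span ⟨a, b, k, h, (basisMat_eq a b k).symm⟩
    | zero => simp
    | add x y _ _ hx hy =>
      rw [Matrix.trace_add, Matrix.single_add, add_sub_add_comm]
      exact add_mem hx hy
    | smul c x _ hx =>
      rw [Matrix.trace_smul, ← Matrix.smul_single, ← smul_sub]
      exact Submodule.smul_mem _ _ hx
  have := key x h1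
  rwa [h2, Matrix.single_zero, sub_zero] at this

theorem rootVec_mem_currentAlg {n : ℕ} (α : PosRoot n) : rootVec α ∈ currentAlg n := (xPos α).2

theorem rootVecNeg_mem_currentAlg {n : ℕ} (α : PosRoot n) : rootVecNeg α ∈ currentAlg n :=
  (xNeg α).2

theorem mem_of_smul_mem {n : ℕ} {x : LoopMat n} {c : ℂ} (hc : c ≠ 0)
    (h : c • x ∈ currentAlg n) : x ∈ currentAlg n := by
  have := (currentAlg n).smul_mem c⁻¹ h
  rwa [smul_smul, inv_mul_cancel₀ hc, one_smul] at this

theorem twist_mem_of_rev {n : ℕ} {a b : Fin (2 * n + 1)} {k : ℤ}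
    (h : twist b.rev a.rev k ∈ currentAlg n) : twist a b k ∈ currentAlg n := by
  have := twist_rev b.rev a.rev k
  rw [Fin.rev_rev, Fin.rev_rev] at this
  rw [this]
  exact (currentAlg n).smul_mem _ h

/-- Antidiagonal entries survive only in odd powers of `t`; hence the long roots see only `ℂ[t²]`.
-/
theorem twist_rev_self {n : ℕ} (a : Fin (2 * n + 1)) {k : ℤ} (h : Even k) :
    twist a a.rev k = 0 := by
  rw [twist, Fin.rev_rev, sgn_rev, sgn_mul_self, h.neg_one_zpow, one_mul, one_smul, sub_self]

theorem basisMat_self_zero {n : ℕ} (a : Fin (2 * n + 1)) :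
    basisMat a a 0 = el a a 1 0 - el a.rev a.rev 1 0 := by
  rw [basisMat, if_pos rfl, twist_mid, twist, sgn_mul_self]
  simp

theorem corootMat_long {n : ℕ} (i : Fin n) : basisMat (lo i) (lo i) 0 = corootMat (.long i) := by
  rw [basisMat_self_zero, rev_lo]; rfl

/-! ### Generation of the spanning vectors: degree zero -/

theorem twist_lo_lo_zero_mem {n : ℕ} {i j : Fin n} (h : i ≠ j) :
    twist (lo i) (lo j) 0 ∈ currentAlg n := by
  rcases lt_or_gt_of_ne h with h | h
  · rw [← rootVec_sub h]; exact rootVec_mem_currentAlg _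
  · rw [← rootVecNeg_sub h]; exact rootVecNeg_mem_currentAlg _

theorem twist_lo_hi_one_mem {n : ℕ} (i j : Fin n) : twist (lo i) (hi j) 1 ∈ currentAlg n := by
  rcases lt_trichotomy i j with h | rfl | h
  · rw [← rootVec_add h]; exact rootVec_mem_currentAlg _
  · have := rootVec_mem_currentAlg (.long i)
    rw [rootVec_long] at this
    exact mem_of_smul_mem (by norm_num) this
  · apply twist_mem_of_rev
    rw [rev_lo, rev_hi, ← rootVec_add h]; exact rootVec_mem_currentAlg _

theorem twist_hi_lo_neg_one_mem {n : ℕ} (i j : Fin n) :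
    twist (hi i) (lo j) (-1) ∈ currentAlg n := by
  rcases lt_trichotomy i j with h | rfl | h
  · apply twist_mem_of_rev
    rw [rev_lo, rev_hi, ← rootVecNeg_add h]; exact rootVecNeg_mem_currentAlg _
  · have := rootVecNeg_mem_currentAlg (.long i)
    rw [rootVecNeg_long] at this
    exact mem_of_smul_mem (by norm_num) this
  · rw [← rootVecNeg_add h]; exact rootVecNeg_mem_currentAlg _

theorem basisMat_lo_zero_mem {n : ℕ} (i : Fin n) : basisMat (lo i) (lo i) 0 ∈ currentAlg n := by
  rw [corootMat_long, ← mat_coroot]; exact (coroot _).2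

/-! ### Generation of the spanning vectors: half-integral degrees -/

/-- For `a = b` the second half of the commutator is exactly the trace correction in `basisMat`.
Brackets through the middle index thus produce all remaining spanning vectors. -/
theorem lie_twist_mid_mid {n : ℕ} {a b : Fin (2 * n + 1)} (ha : a ≠ mid n) (hb : b ≠ mid n)
    (k l : ℤ) : ⁅twist a (mid n) k, twist (mid n) b l⁆ = basisMat a b (k + l) := by
  have h1 : ¬ mid n = b.rev := fun h => hb (by rw [← Fin.rev_rev b, ← h, rev_mid])
  have h2 : ¬ (mid n).rev = a := by rw [rev_mid]; exact ha.symm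
  rw [lie_twist, if_pos rfl, if_neg h1, if_neg h2, sub_zero, smul_zero, sub_zero, basisMat]
  simp only [eq_comm]

theorem lie_twist_mid_lo {n : ℕ} (i : Fin n) (b : Fin (2 * n + 1)) (k l : ℤ) (hb : b ≠ mid n)
    (hb' : b ≠ hi i) :
    ⁅twist (mid n) (lo i) k, twist (lo i) b l⁆ = twist (mid n) b (k + l) := by
  rw [lie_twist, if_pos rfl, if_neg hb, if_neg, if_neg, sub_zero, sub_zero, smul_zero, sub_zero]
  · rw [rev_lo]; exact hi_ne_mid i
  · intro h
    exact hb' (by rw [← Fin.rev_rev b, ← h, rev_lo])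

theorem lie_twist_mid_lo_hi {n : ℕ} (i : Fin n) (k : ℤ) {l : ℤ} (hl : Odd l) :
    ⁅twist (mid n) (lo i) k, twist (lo i) (hi i) l⁆ = (2 : ℂ) • twist (mid n) (hi i) (k + l) := by
  rw [lie_twist, if_pos rfl, if_neg (hi_ne_mid i), if_pos (rev_hi i).symm, if_neg, rev_lo,
    sgn_hi, sgn_lo, sign_mul, hl.neg_one_zpow]
  · module
  · rw [rev_lo]; exact hi_ne_mid i

/-- In degree one the diagonal element has entry `1` at `b` and `-2` at the middle, whence the
factor `1 - (-2) = 3`. Being nonzero, it lets the power of `t` be raised one step at a time. -/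
theorem lie_twist_mid_basisMat {n : ℕ} {b : Fin (2 * n + 1)} (hb : b ≠ mid n) (k : ℤ) :
    ⁅twist (mid n) b k, basisMat b b 1⁆ = (3 : ℂ) • twist (mid n) b (k + 1) := by
  have hb' : b ≠ b.rev := by
    intro h
    apply hb
    rcases index_cases b with ⟨i, rfl⟩ | rfl | ⟨i, rfl⟩
    · rw [rev_lo] at h; exact absurd h (lo_ne_hi _ _)
    · rfl
    · rw [rev_hi] at h; exact absurd h.symm (lo_ne_hi _ _)
  rw [basisMat, if_pos rfl, lie_sub, lie_twist, lie_twist, if_pos rfl, if_neg hb, if_neg hb',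
    if_neg, if_neg hb, if_pos rfl, rev_mid, if_neg hb, if_pos rfl, sgn_mid]
  · simp only [zpow_one]; module
  · intro h; exact hb (by rw [← Fin.rev_rev b, h, rev_mid])

theorem twist_mid_lo_zero_mem {n : ℕ} (i : Fin n) : twist (mid n) (lo i) 0 ∈ currentAlg n := by
  have h0 : twist (mid n) 0 0 ∈ currentAlg n := by
    rw [← affineVec_eq]; exact LieSubalgebra.subset_lieSpan (Or.inr rfl)
  have hn : 0 < n := i.pos
  have e : (0 : Fin (2 * n + 1)) = lo ⟨0, hn⟩ := rfl
  rw [e] at h0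
  by_cases h : (⟨0, hn⟩ : Fin n) = i
  · rwa [h] at h0
  · have := (currentAlg n).lie_mem h0 (twist_lo_lo_zero_mem h)
    rwa [lie_twist_mid_lo _ _ _ _ (lo_ne_mid i) (lo_ne_hi _ _)] at this

theorem twist_mid_hi_one_mem {n : ℕ} (i : Fin n) : twist (mid n) (hi i) 1 ∈ currentAlg n := by
  have := (currentAlg n).lie_mem (twist_mid_lo_zero_mem i) (twist_lo_hi_one_mem i i)
  rw [lie_twist_mid_lo_hi i 0 odd_one] at this
  exact mem_of_smul_mem (by norm_num) this

theorem twist_mid_mem_of_start {n : ℕ} {b : Fin (2 * n + 1)} (hb : b ≠ mid n)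
    (h1 : basisMat b b 1 ∈ currentAlg n) {k₀ : ℤ} (h0 : twist (mid n) b k₀ ∈ currentAlg n)
    {k : ℤ} (hk : k₀ ≤ k) : twist (mid n) b k ∈ currentAlg n := by
  induction k, hk using Int.leInduction with
  | base => exact h0
  | succ k _ ih =>
    have := (currentAlg n).lie_mem ih h1
    rw [lie_twist_mid_basisMat hb] at this
    exact mem_of_smul_mem (by norm_num) this

theorem twist_mid_lo_mem {n : ℕ} (i : Fin n) {k : ℤ} (hk : 0 ≤ k) :
    twist (mid n) (lo i) k ∈ currentAlg n := by
  refine twist_mid_mem_of_start (lo_ne_mid i) ?_ (twist_mid_lo_zero_mem i) hk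
  rw [← add_zero (1 : ℤ), ← lie_twist_mid_mid (lo_ne_mid i) (lo_ne_mid i)]
  refine (currentAlg n).lie_mem (twist_mem_of_rev ?_) (twist_mid_lo_zero_mem i)
  rw [rev_mid, rev_lo]; exact twist_mid_hi_one_mem i

theorem twist_mid_hi_mem {n : ℕ} (i : Fin n) {k : ℤ} (hk : 1 ≤ k) :
    twist (mid n) (hi i) k ∈ currentAlg n := by
  refine twist_mid_mem_of_start (hi_ne_mid i) ?_ (twist_mid_hi_one_mem i) hk
  rw [← zero_add (1 : ℤ), ← lie_twist_mid_mid (hi_ne_mid i) (hi_ne_mid i)]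
  refine (currentAlg n).lie_mem (twist_mem_of_rev ?_) (twist_mid_hi_one_mem i)
  rw [rev_mid, rev_hi]; exact twist_mid_lo_zero_mem i

theorem twist_mid_mem {n : ℕ} {b : Fin (2 * n + 1)} (hb : b ≠ mid n) {k : ℤ}
    (h : Nonneg (mid n) b k) : twist (mid n) b k ∈ currentAlg n := by
  unfold Nonneg at h
  rw [idxDeg_mid] at h
  rcases index_cases b with ⟨i, rfl⟩ | rfl | ⟨i, rfl⟩
  · rw [idxDeg_lo] at h; exact twist_mid_lo_mem i (by omega)
  · exact absurd rfl hb
  · rw [idxDeg_hi] at h; exact twist_mid_hi_mem i (by omega)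

theorem twist_mem_mid {n : ℕ} {a : Fin (2 * n + 1)} (ha : a ≠ mid n) {k : ℤ}
    (h : Nonneg a (mid n) k) : twist a (mid n) k ∈ currentAlg n := by
  apply twist_mem_of_rev
  have := h.rev
  rw [rev_mid] at this ⊢
  exact twist_mid_mem (fun h' => ha (by rw [← Fin.rev_rev a, h', rev_mid])) this

/-- For `a`, `b` off the middle, the smallest admissible `k` gives elements of `𝔤`. Every larger `k`
splits as a sum of admissible powers for `(a, mid)` and `(mid, b)`, and the bracket through the
middle index applies. -/
theorem basisMat_mem {n : ℕ} {a b : Fin (2 * n + 1)} {k : ℤ} (h : Nonneg a b k) :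
    basisMat a b k ∈ currentAlg n := by
  by_cases hb : b = mid n
  · subst hb
    by_cases ha : a = mid n
    · subst ha; rw [basisMat, if_pos rfl, sub_self]; exact zero_mem _
    · rw [basisMat_of_ne ha]; exact twist_mem_mid ha h
  by_cases ha : a = mid n
  · subst ha; rw [basisMat_of_ne (Ne.symm hb)]; exact twist_mid_mem hb h
  have key : ∀ l m : ℤ, l + m = k → Nonneg a (mid n) l → Nonneg (mid n) b m →
      basisMat a b k ∈ currentAlg n := fun l m e h1 h2 => by
    rw [← e, ← lie_twist_mid_mid ha hb]
    exact (currentAlg n).lie_mem (twist_mem_mid ha h1) (twist_mid_mem hb h2)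
  unfold Nonneg at h key
  rw [idxDeg_mid] at key
  rcases index_cases a with ⟨i, rfl⟩ | rfl | ⟨i, rfl⟩
  · rcases index_cases b with ⟨j, rfl⟩ | rfl | ⟨j, rfl⟩
    · rw [idxDeg_lo, idxDeg_lo] at *
      by_cases hk : k = 0
      · subst hk
        by_cases hij : i = j
        · subst hij; exact basisMat_lo_zero_mem i
        · rw [basisMat_of_ne (lo_ne_lo hij)]; exact twist_lo_lo_zero_mem hij
      · exact key 1 (k - 1) (by omega) (by omega) (by omega)
    · exact absurd rfl hb
    · rw [idxDeg_lo, idxDeg_hi] at *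
      by_cases hk : k = 1
      · subst hk; rw [basisMat_of_ne (lo_ne_hi _ _)]; exact twist_lo_hi_one_mem i j
      · exact key 1 (k - 1) (by omega) (by omega) (by omega)
  · exact absurd rfl ha
  · rcases index_cases b with ⟨j, rfl⟩ | rfl | ⟨j, rfl⟩
    · rw [idxDeg_lo, idxDeg_hi] at *
      by_cases hk : k = -1
      · subst hk; rw [basisMat_of_ne (lo_ne_hi _ _).symm]; exact twist_hi_lo_neg_one_mem i j
      · exact key 0 k (by omega) (by omega) (by omega)
    · exact absurd rfl hb
    · rw [idxDeg_hi, idxDeg_hi] at *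
      by_cases hk : k = 0
      · subst hk
        by_cases hij : i = j
        · subst hij
          have := (currentAlg n).neg_mem (basisMat_lo_zero_mem i)
          rw [basisMat_self_zero, neg_sub, rev_lo] at this
          rwa [basisMat_self_zero, rev_hi]
        · rw [basisMat_of_ne (hi_ne_hi hij)]
          apply twist_mem_of_rev
          rw [rev_hi, rev_hi]; exact twist_lo_lo_zero_mem (Ne.symm hij)
      · exact key 0 k (by omega) (by omega) (by omega)

/-- The spanning vectors of the current algebra. -/
def basisElt {n : ℕ} (a b : Fin (2 * n + 1)) (k : ℤ) (h : Nonneg a b k) : currentAlg n :=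
  ⟨basisMat a b k, basisMat_mem h⟩

theorem span_basisElt (n : ℕ) :
    Submodule.span ℂ {x : currentAlg n | ∃ a b k h, x = basisElt a b k h} = ⊤ := by
  rw [eq_top_iff]
  rintro ⟨x, hx⟩ -
  have h := mem_span_basisMat hx
  have e : {x : LoopMat n | ∃ a b k, Nonneg a b k ∧ x = basisMat a b k} =
      (currentAlg n).toSubmodule.subtype '' {x : currentAlg n | ∃ a b k h, x = basisElt a b k h} := by
    ext y
    constructor
    · rintro ⟨a, b, k, h, rfl⟩
      exact ⟨basisElt a b k h, ⟨a, b, k, h, rfl⟩, rfl⟩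
    · rintro ⟨_, ⟨a, b, k, h, rfl⟩, rfl⟩
      exact ⟨a, b, k, h, rfl⟩
  rw [e, ← Submodule.map_span] at h
  obtain ⟨y, hy, hyx⟩ := h
  have : y = ⟨x, hx⟩ := Subtype.ext hyx
  rwa [← this]

/-! ### A Garland type identity for `sl₂ ⊗ ℂ[u]` -/

section Garland
variable {R W : Type*} [CommRing R] [AddCommGroup W] [Module R W]

/-- `CurrentMonomial f w a d v`: `v` is a product of `a` operators `f m` of total degree `d`
applied to `w`. -/
inductive CurrentMonomial (f : ℕ → W →ₗ[R] W) (w : W) : ℕ → ℕ → W → Prop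
  | base : CurrentMonomial f w 0 0 w
  | step (m a d : ℕ) (v : W) (h : CurrentMonomial f w a d v) :
      CurrentMonomial f w (a + 1) (d + m) (f m v)

/-- Pairs of a vector and its leading coefficient: monomials of degree `d` have leading coefficient
`1`, those of smaller degree have leading coefficient `0`. -/
def leadingSpan (f : ℕ → W →ₗ[R] W) (w : W) (a d : ℕ) : Submodule R (W × R) :=
  Submodule.span R ({x | ∃ v, CurrentMonomial f w a d v ∧ x = (v, 1)} ∪
    {x | ∃ v d', d' < d ∧ CurrentMonomial f w a d' v ∧ x = (v, 0)})

variable {f h : ℕ → W →ₗ[R] W} {e : W →ₗ[R] W} {w : W}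

theorem mem_leadingSpan {a d : ℕ} {v : W} (hv : CurrentMonomial f w a d v) :
    (v, (1 : R)) ∈ leadingSpan f w a d := Submodule.subset_span (Or.inl ⟨v, hv, rfl⟩)

theorem mem_leadingSpan_of_lt {a d d' : ℕ} {v : W} (hd : d' < d)
    (hv : CurrentMonomial f w a d' v) :
    (v, (0 : R)) ∈ leadingSpan f w a d := Submodule.subset_span (Or.inr ⟨v, d', hd, hv, rfl⟩)

theorem leadingSpan_map {a d a' d' : ℕ} (Φ : W × R →ₗ[R] W × R)
    (h1 : ∀ v, CurrentMonomial f w a d v → Φ (v, 1) ∈ leadingSpan f w a' d')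
    (h2 : ∀ v c, c < d → CurrentMonomial f w a c v → Φ (v, 0) ∈ leadingSpan f w a' d')
    {x : W × R} (hx : x ∈ leadingSpan f w a d) : Φ x ∈ leadingSpan f w a' d' := by
  suffices leadingSpan f w a d ≤ (leadingSpan f w a' d').comap Φ from this hx
  refine Submodule.span_le.2 (Set.union_subset ?_ ?_)
  · rintro _ ⟨v, hv, rfl⟩; exact h1 v hv
  · rintro _ ⟨v, c, hc, hv, rfl⟩; exact h2 v c hc hv

theorem leadingSpan_lower {a d d' : ℕ} (hd : d' < d) {x : W × R}
    (hx : x ∈ leadingSpan f w a d') : (x.1, (0 : R)) ∈ leadingSpan f w a d := by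
  refine leadingSpan_map (LinearMap.prodMap LinearMap.id 0) ?_ ?_ hx
  · intro v hv; exact mem_leadingSpan_of_lt hd hv
  · intro v c hc hv; exact mem_leadingSpan_of_lt (hc.trans hd) hv

theorem leadingSpan_f {a d : ℕ} (m : ℕ) {x : W × R} (hx : x ∈ leadingSpan f w a d) :
    (f m x.1, x.2) ∈ leadingSpan f w (a + 1) (d + m) := by
  refine leadingSpan_map (LinearMap.prodMap (f m) LinearMap.id) ?_ ?_ hx
  · intro v hv; exact mem_leadingSpan (.step m a d v hv)
  · intro v c hc hv; exact mem_leadingSpan_of_lt (by omega) (.step m a c v hv)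

/-- Commuting `h p` to the right shifts each of the `a` factors once by `p`, with coefficient `-2`.
The remaining term `η p • v` keeps degree `d < d + p`. Coefficients are tracked in pairs because the
monomials may be linearly dependent in `W`. -/
theorem leadingSpan_h_monomial (hhf : ∀ p m v, h p (f m v) = f m (h p v) - (2 : R) • f (m + p) v)
    {η : ℕ → R} (hw : ∀ p, 1 ≤ p → h p w = η p • w) {p : ℕ} (hp : 1 ≤ p) {a d : ℕ} {v : W}
    (hv : CurrentMonomial f w a d v) :
    (h p v, (-2 * a : R)) ∈ leadingSpan f w a (d + p) := by
  induction hv with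
  | base =>
    rw [hw p hp]
    have := (leadingSpan f w 0 (0 + p)).smul_mem (η p)
      (mem_leadingSpan_of_lt (R := R) (f := f) (d := 0 + p) (by omega) .base)
    simpa using this
  | step m a d v hv ih =>
    have h1 := leadingSpan_f m ih
    have h2 := (leadingSpan f w (a + 1) (d + (m + p))).smul_mem (-2 : R)
      (mem_leadingSpan (.step (m + p) a d v hv))
    rw [show d + p + m = d + (m + p) by ring] at h1
    rw [show d + m + p = d + (m + p) by ring]
    rw [hhf]
    convert add_mem h1 h2 using 1
    ext
    · simp [sub_eq_add_neg]
    · simp; ring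

/-- Commuting `e` to the right turns each factor into an `h` acting on the factors after it. A
factor followed by `b` others contributes `-2b`, and the sum over `b < a` is `-a(a - 1)`. -/
theorem leadingSpan_e_monomial (hef : ∀ m v, e (f m v) = f m (e v) + h (m + 1) v)
    (hhf : ∀ p m v, h p (f m v) = f m (h p v) - (2 : R) • f (m + p) v) {η : ℕ → R} (he : e w = 0)
    (hw : ∀ p, 1 ≤ p → h p w = η p • w) {a d : ℕ} {v : W} (hv : CurrentMonomial f w a d v) :
    (e v, (-(a * (a - 1)) : R)) ∈ leadingSpan f w (a - 1) (d + 1) := by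
  induction hv with
  | base =>
    rw [he, show (-(((0 : ℕ) : R) * (((0 : ℕ) : R) - 1))) = 0 by simp]
    exact zero_mem (leadingSpan f w (0 - 1) (0 + 1))
  | step m a d v hv ih =>
    have h1 := leadingSpan_h_monomial hhf hw (p := m + 1) (by omega) hv
    rw [hef, Nat.add_sub_cancel]
    rw [show d + (m + 1) = d + m + 1 by ring] at h1
    -- Restoring the factor `f m` gives `a - 1 + 1` factors, which is `a` only for `a > 0`; for `a =
    -- 0` the term vanishes because `e w = 0`.
    cases hv with
    | base => rw [he, map_zero, zero_add]; simpa using h1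
    | step m' a d v hv =>
      have h2 := leadingSpan_f m ih
      rw [Nat.add_sub_cancel] at h2
      rw [show d + m' + 1 + m = d + m' + m + 1 by ring] at h2
      convert add_mem h2 h1 using 1
      ext
      · simp
      · simp; ring

theorem leadingSpan_e (hef : ∀ m v, e (f m v) = f m (e v) + h (m + 1) v)
    (hhf : ∀ p m v, h p (f m v) = f m (h p v) - (2 : R) • f (m + p) v) {η : ℕ → R} (he : e w = 0)
    (hw : ∀ p, 1 ≤ p → h p w = η p • w) {a d : ℕ} {x : W × R} (hx : x ∈ leadingSpan f w a d) :
    (e x.1, (-(a * (a - 1)) : R) * x.2) ∈ leadingSpan f w (a - 1) (d + 1) := by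
  refine leadingSpan_map
    (LinearMap.prodMap e (LinearMap.mulLeft R (-(a * (a - 1)) : R))) ?_ ?_ hx
  · intro v hv
    simpa using leadingSpan_e_monomial hef hhf he hw hv
  · intro v c hc hv
    simpa using leadingSpan_lower (show c + 1 < d + 1 by omega)
      (leadingSpan_e_monomial hef hhf he hw hv)

/-- With a single factor the only monomial of degree `d` is `f d w`, so the formal leading
coefficient acquires a meaning in `W`. -/
theorem leadingSpan_one {d : ℕ} {x : W × R} (hx : x ∈ leadingSpan f w 1 d) :
    x.1 - x.2 • f d w ∈ Submodule.span R {v | ∃ j < d, v = f j w} := by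
  have key : ∀ c v, CurrentMonomial f w 1 c v → v = f c w := by
    rintro c v (_ | ⟨m, a, d, v, hv⟩)
    cases hv
    rw [zero_add]
  let Φ : W × R →ₗ[R] W := LinearMap.fst R W R -
    (LinearMap.toSpanSingleton R W (f d w)).comp (LinearMap.snd R W R)
  suffices leadingSpan f w 1 d ≤ (Submodule.span R {v | ∃ j < d, v = f j w}).comap Φ from this hx
  refine Submodule.span_le.2 (Set.union_subset ?_ ?_)
  · rintro _ ⟨v, hv, rfl⟩
    simp [Φ, key _ _ hv]
  · rintro _ ⟨v, c, hc, hv, rfl⟩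
    have : f c w ∈ Submodule.span R {v | ∃ j < d, v = f j w} :=
      Submodule.subset_span ⟨c, hc, rfl⟩
    simpa [Φ, key _ _ hv] using this

theorem leadingSpan_e_pow (hef : ∀ m v, e (f m v) = f m (e v) + h (m + 1) v)
    (hhf : ∀ p m v, h p (f m v) = f m (h p v) - (2 : R) • f (m + p) v) {η : ℕ → R} (he : e w = 0)
    (hw : ∀ p, 1 ≤ p → h p w = η p • w) (N k : ℕ) (hk : k < N) :
    ∃ c : ℤ, c ≠ 0 ∧ ((e ^ k) ((f 0 ^ N) w), (c : R)) ∈ leadingSpan f w (N - k) k := by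
  induction k with
  | zero =>
    refine ⟨1, one_ne_zero, ?_⟩
    have : ∀ N, CurrentMonomial f w N 0 ((f 0 ^ N) w) := fun N => by
      induction N with
      | zero => exact .base
      | succ N ih => rw [pow_succ', Module.End.mul_apply]; exact .step 0 N 0 _ ih
    simpa using mem_leadingSpan (R := R) (this N)
  | succ k ih =>
    obtain ⟨c, hc, h1⟩ := ih (by omega)
    have h2 := leadingSpan_e hef hhf he hw h1
    -- There are `j + 2` factors left before this application of `e`, so it contributes the nonzero
    -- factor `-(j + 2)(j + 1)`.
    obtain ⟨j, rfl⟩ : ∃ j, N = k + 1 + (j + 1) := ⟨N - k - 2, by omega⟩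
    refine ⟨-((j + 2) * (j + 1)) * c, mul_ne_zero (by
      rw [neg_ne_zero]; positivity) hc, ?_⟩
    rw [show k + 1 + (j + 1) - k - 1 = k + 1 + (j + 1) - (k + 1) by omega] at h2
    rw [show k + 1 + (j + 1) - k = j + 2 by omega] at h2
    rw [pow_succ', Module.End.mul_apply]
    convert h2 using 2
    push_cast
    ring

/-- Finite generation of `∑ R f_m w` for a highest weight vector `w` with `f_0^N w = 0`. -/
theorem garland_finite [Algebra ℂ R] (hef : ∀ m v, e (f m v) = f m (e v) + h (m + 1) v)
    (hhf : ∀ p m v, h p (f m v) = f m (h p v) - (2 : R) • f (m + p) v) {η : ℕ → R} (he : e w = 0)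
    (hw : ∀ p, 1 ≤ p → h p w = η p • w) {N : ℕ} (hN : (f 0 ^ (N + 1)) w = 0) (m : ℕ) :
    f m w ∈ Submodule.span R {v | ∃ j < N, v = f j w} := by
  set S := Submodule.span R {v | ∃ j < N, v = f j w} with hS
  have unit : ∀ c : ℤ, c ≠ 0 → IsUnit (c : R) := fun c hc => by
    have := (IsUnit.mk0 (c : ℂ) (by exact_mod_cast hc)).map (algebraMap ℂ R)
    simpa using this
  -- In `e^N f_0^{N+1} w = 0` one factor of degree `N` remains, with a leading coefficient that is a
  -- unit.
  have hfN : f N w ∈ S := by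
    obtain ⟨c, hc, h1⟩ := leadingSpan_e_pow hef hhf he hw (N + 1) N (by omega)
    rw [hN, map_zero, show N + 1 - N = 1 by omega] at h1
    have h2 := leadingSpan_one h1
    rw [zero_sub, neg_mem_iff] at h2
    exact (Submodule.smul_mem_iff_of_isUnit S (unit c hc)).1 h2
  -- From degree `N` on, `h 1` replaces the Garland argument: it raises the degree by one and
  -- preserves `S`.
  have hstep : ∀ j, f j w ∈ S → h 1 (f j w) ∈ S → f (j + 1) w ∈ S := fun j h1 h2 => by
    have h3 := hhf 1 j w
    rw [hw 1 le_rfl, map_smul] at h3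
    have h4 : (2 : R) • f (j + 1) w = η 1 • f j w - h 1 (f j w) := by rw [h3]; abel
    have h5 : (2 : R) • f (j + 1) w ∈ S := by
      rw [h4]; exact sub_mem (S.smul_mem _ h1) h2
    exact (Submodule.smul_mem_iff_of_isUnit S (by exact_mod_cast unit 2 (by norm_num))).1 h5
  have hh : S ≤ S.comap (h 1) := by
    rw [hS, Submodule.span_le, ← hS]
    rintro _ ⟨j, hj, rfl⟩
    change h 1 (f j w) ∈ S
    rw [hhf, hw 1 le_rfl, map_smul]
    refine sub_mem (S.smul_mem _ (Submodule.subset_span ⟨j, hj, rfl⟩)) (S.smul_mem _ ?_)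
    rcases Nat.lt_or_ge (j + 1) N with hj' | hj'
    · exact Submodule.subset_span ⟨j + 1, hj', rfl⟩
    · rw [show j + 1 = N by omega]; exact hfN
  rcases Nat.lt_or_ge m N with hm | hm
  · exact Submodule.subset_span ⟨m, hm, rfl⟩
  · induction m, hm using Nat.le_induction with
    | base => exact hfN
    | succ j _ ih => exact hstep j ih (hh ih)

end Garland

/-! ### Position of the spanning vectors in the triangular decomposition -/

theorem basisElt_mem_nPlus {n : ℕ} {a b : Fin (2 * n + 1)} (hab : a < b) {k : ℤ}
    (h : Nonneg a b k) : basisElt a b k h ∈ nPlus n := by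
  intro c d hcd
  change basisMat a b k c d = 0
  rw [basisMat_of_ne hab.ne, twist, Matrix.sub_apply, Matrix.smul_apply, el_apply_ne, el_apply_ne,
    smul_zero, sub_zero]
  · rintro ⟨rfl, rfl⟩; exact absurd hab (not_lt.2 (Fin.rev_le_rev.1 hcd))
  · rintro ⟨rfl, rfl⟩; exact absurd hab (not_lt.2 hcd)

theorem coeff_el_self {n : ℕ} (a c : Fin (2 * n + 1)) {j k : ℤ} (h : j ≠ k) :
    (el a a 1 k c c).coeff j = 0 := by
  by_cases hac : a = c
  · subst hac
    rw [el, Matrix.single_apply_same, map_one, one_mul]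
    exact Finsupp.single_eq_of_ne h
  · rw [el_apply_ne _ _ _ _ _ _ (fun h => hac h.1)]; rfl

theorem basisElt_mem_hPlus {n : ℕ} {a : Fin (2 * n + 1)} {k : ℤ} (hk : 0 < k)
    (h : Nonneg a a k) : basisElt a a k h ∈ hPlus n := by
  have e : mat (basisElt a a k h) = el a a 1 k - (sgn a * sgn a * (-1) ^ k) • el a.rev a.rev 1 k
      - (1 - (-1 : ℂ) ^ k) • el (mid n) (mid n) 1 k := by
    change basisMat a a k = _
    rw [basisMat, if_pos rfl, twist_mid]; rfl
  refine ⟨fun c d hcd => ?_, fun c j hj => ?_⟩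
  · have : ∀ a, el a a 1 k c d = 0 := fun a => el_apply_ne _ _ _ _ _ _ (by
      rintro ⟨rfl, rfl⟩; exact hcd rfl)
    rw [e]
    simp [this]
  · have : ∀ a, (el a a 1 k c c).coeff j = 0 := fun a => coeff_el_self a c (by omega)
    rw [e]
    simp [this]

theorem basisElt_mem_cartan {n : ℕ} (a : Fin (2 * n + 1)) (h : Nonneg a a 0) :
    basisElt a a 0 h ∈ cartan n := by
  rcases index_cases a with ⟨i, rfl⟩ | rfl | ⟨i, rfl⟩
  · refine Submodule.subset_span ⟨.long i, Subtype.ext ?_⟩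
    exact (mat_coroot _).trans (corootMat_long i).symm
  · convert zero_mem (cartan n)
    apply Subtype.ext
    change basisMat _ _ _ = 0
    rw [basisMat, if_pos rfl, sub_self]
  · have : basisElt (hi i) (hi i) 0 h = -coroot (.long i) := by
      apply Subtype.ext
      change basisMat _ _ _ = -mat (coroot _)
      rw [mat_coroot, ← corootMat_long, basisMat_self_zero, basisMat_self_zero, rev_lo, rev_hi,
        neg_sub]
    rw [this]
    exact neg_mem (Submodule.subset_span ⟨_, rfl⟩)

/-! ### The action of the current algebra by operators commuting with the right action -/

section
variable {n : ℕ} (wt : Module.Dual ℂ (cartan n))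

theorem smul_uh_smul (y : UCur n) (u : UH n) (v : GlobalWeyl wt) : y • u • v = u • y • v :=
  (map_smul (rightAct wt u) y v).symm

theorem algebraMap_uh_smul (c : ℂ) (v : GlobalWeyl wt) : algebraMap ℂ (UH n) c • v = c • v := by
  obtain ⟨y, rfl⟩ := toWeyl_surjective wt v
  have h : toWeyl wt (algebraMap ℂ (UCur n) c * y) = algebraMap ℂ (UCur n) c • toWeyl wt y :=
    map_smul (toWeyl wt) _ y
  rw [uh_smul_toWeyl, AlgHom.commutes, ← Algebra.commutes, h, algebraMap_smul]

/-- The action of `x ∈ C𝔤` on `W(λ)`, linear for the right action. -/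
def act (x : currentAlg n) : GlobalWeyl wt →ₗ[UH n] GlobalWeyl wt where
  toFun v := inc x • v
  map_add' := smul_add _
  map_smul' u v := smul_uh_smul wt _ u v

theorem act_add (x y : currentAlg n) (v : GlobalWeyl wt) :
    act wt (x + y) v = act wt x v + act wt y v := by
  have h : inc (x + y) = inc x + inc y := map_add _ x y
  change inc (x + y) • v = _
  rw [h, add_smul]; rfl

theorem act_smul (c : ℂ) (x : currentAlg n) (v : GlobalWeyl wt) :
    act wt (c • x) v = algebraMap ℂ (UH n) c • act wt x v := by
  have h : inc (c • x) = c • inc x := map_smul _ c x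
  change inc (c • x) • v = _
  rw [h, smul_assoc, algebraMap_uh_smul]; rfl

theorem act_zero (v : GlobalWeyl wt) : act wt 0 v = 0 := by
  have h : inc (0 : currentAlg n) = 0 := map_zero _
  change inc (0 : currentAlg n) • v = _
  rw [h, zero_smul]

theorem act_lie (x y : currentAlg n) (v : GlobalWeyl wt) :
    act wt x (act wt y v) = act wt ⁅x, y⁆ v + act wt y (act wt x v) := by
  change inc x • inc y • v = inc ⁅x, y⁆ • v + inc y • inc x • v
  rw [← mul_smul, inc_mul, add_smul, mul_smul]

theorem act_pow (x : currentAlg n) (k : ℕ) (v : GlobalWeyl wt) :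
    (act wt x ^ k) v = inc x ^ k • v := by
  induction k with
  | zero => simp
  | succ k ih => rw [pow_succ', Module.End.mul_apply, ih, pow_succ', mul_smul]; rfl

theorem act_nPlus {x : currentAlg n} (hx : x ∈ nPlus n) : act wt x (wGen wt) = 0 :=
  (isHighest_wGen wt).1 x hx

theorem act_hPlus (x : hPlus n) :
    act wt x (wGen wt) = (UniversalEnvelopingAlgebra.ι ℂ x : UH n) • wGen wt := by
  conv_rhs => rw [wGen, uh_smul_toWeyl, one_mul, incH_ι, toWeyl_apply]
  rfl

theorem act_cartan (x : cartan n) :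
    act wt x (wGen wt) = algebraMap ℂ (UH n) (wt x) • wGen wt := by
  rw [algebraMap_uh_smul]; exact (isHighest_wGen wt).2 x

theorem act_mem_of_span {S T : Submodule (UH n) (GlobalWeyl wt)} {B : Set (currentAlg n)}
    (h : ∀ x ∈ B, S ≤ T.comap (act wt x)) {x : currentAlg n} (hx : x ∈ Submodule.span ℂ B) :
    S ≤ T.comap (act wt x) := by
  intro v hv
  change act wt x v ∈ T
  induction hx using Submodule.span_induction with
  | mem x hx => exact h x hx hv
  | zero => rw [act_zero]; exact zero_mem _
  | add x y _ _ hx hy => rw [act_add]; exact add_mem hx hy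
  | smul c x _ hx => rw [act_smul]; exact Submodule.smul_mem _ _ hx

/-! ### The subalgebras `sl₂ ⊗ ℂ[t²]` of the long roots -/

theorem twist_hi_lo_odd (i : Fin n) {q : ℤ} (hq : Odd q) :
    twist (hi i) (lo i) q = (2 : ℂ) • el (hi i) (lo i) 1 q := by
  rw [twist, rev_lo, rev_hi, sgn_lo, sgn_hi, sign_mul, hq.neg_one_zpow]
  module

theorem twist_lo_hi_odd (i : Fin n) {q : ℤ} (hq : Odd q) :
    twist (lo i) (hi i) q = (2 : ℂ) • el (lo i) (hi i) 1 q := by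
  rw [twist, rev_lo, rev_hi, sgn_lo, sgn_hi, sign_mul, hq.neg_one_zpow]
  module

theorem nonneg_hi_lo (i j : Fin n) {q : ℤ} (hq : -1 ≤ q) : Nonneg (hi i) (lo j) q := by
  unfold Nonneg; rw [idxDeg_lo, idxDeg_hi]; omega

theorem nonneg_lo_hi (i j : Fin n) {q : ℤ} (hq : 1 ≤ q) : Nonneg (lo i) (hi j) q := by
  unfold Nonneg; rw [idxDeg_lo, idxDeg_hi]; omega

theorem nonneg_self (a : Fin (2 * n + 1)) {q : ℤ} (hq : 0 ≤ q) : Nonneg a a q := by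
  unfold Nonneg; omega

/-- The element `E_{i',i} ⊗ t^{2m-1}`. -/
def longNeg (i : Fin n) (m : ℕ) : currentAlg n :=
  (2⁻¹ : ℂ) • basisElt (hi i) (lo i) (2 * m - 1) (nonneg_hi_lo i i (by omega))

/-- The element `E_{i,i'} ⊗ t^3`. -/
def longPos (i : Fin n) : currentAlg n :=
  (2⁻¹ : ℂ) • basisElt (lo i) (hi i) 3 (nonneg_lo_hi i i (by omega))

/-- The element `(E_{i,i} - E_{i',i'}) ⊗ t^{2p}`. -/
def longCartan (i : Fin n) (p : ℕ) : currentAlg n :=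
  basisElt (lo i) (lo i) (2 * p) (nonneg_self _ (by omega))

theorem mat_longNeg (i : Fin n) (m : ℕ) : mat (longNeg i m) = el (hi i) (lo i) 1 (2 * m - 1) := by
  change (2⁻¹ : ℂ) • basisMat _ _ _ = _
  rw [basisMat_of_ne (lo_ne_hi _ _).symm, twist_hi_lo_odd _ ⟨m - 1, by ring⟩, smul_smul]
  norm_num

theorem mat_longPos (i : Fin n) : mat (longPos i) = el (lo i) (hi i) 1 3 := by
  change (2⁻¹ : ℂ) • basisMat _ _ _ = _
  rw [basisMat_of_ne (lo_ne_hi _ _), twist_lo_hi_odd _ ⟨1, by ring⟩, smul_smul]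
  norm_num

theorem mat_longCartan (i : Fin n) (p : ℕ) :
    mat (longCartan i p) = el (lo i) (lo i) 1 (2 * p) - el (hi i) (hi i) 1 (2 * p) := by
  change basisMat _ _ _ = _
  have h : Even (2 * (p : ℤ)) := even_two_mul _
  rw [basisMat, if_pos rfl, twist_mid, twist, sgn_mul_self, h.neg_one_zpow, rev_lo]
  simp

theorem mat_lie (x y : currentAlg n) : mat ⁅x, y⁆ = mat x * mat y - mat y * mat x := rfl

theorem lie_longPos_longNeg (i : Fin n) (m : ℕ) :
    ⁅longPos i, longNeg i m⁆ = longCartan i (m + 1) := by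
  apply Subtype.ext
  change mat _ = mat _
  rw [mat_lie, mat_longPos, mat_longNeg, mat_longCartan, el_mul_same, el_mul_same]
  push_cast
  ring_nf

theorem lie_longCartan_longNeg (i : Fin n) (p m : ℕ) :
    ⁅longCartan i p, longNeg i m⁆ = (-2 : ℂ) • longNeg i (m + p) := by
  apply Subtype.ext
  change mat _ = (-2 : ℂ) • mat _
  rw [mat_lie, mat_longNeg, mat_longNeg, mat_longCartan, sub_mul, mul_sub, el_mul_same,
    el_mul_same, el_mul_ne _ _ _ _ _ _ _ _ (lo_ne_hi _ _),
    el_mul_ne _ _ _ _ _ _ _ _ (lo_ne_hi _ _), mul_one]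
  push_cast
  rw [show 2 * (p : ℤ) + (2 * m - 1) = 2 * (m + p) - 1 by ring,
    show (2 * (m : ℤ) - 1) + 2 * p = 2 * (m + p) - 1 by ring]
  module

theorem longNeg_zero (i : Fin n) : longNeg i 0 = xNeg (.long i) := by
  apply Subtype.ext
  exact (mat_longNeg i 0).trans rfl

theorem lo_lt_hi (i j : Fin n) : lo i < hi j := by
  rw [Fin.lt_def]; simp only [lo, hi]; omega

/-- The Garland identity applies with `u = t²`, `x⁻ = E_{i',i} t^{-1}` and `x⁺ = E_{i,i'} t`; its
`e` is `x⁺ ⊗ u`. -/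
theorem act_longNeg_mem (i : Fin n) {N : ℕ} (hN : wt (corootH (.long i)) = N) (m : ℕ) :
    act wt (longNeg i m) (wGen wt) ∈
      Submodule.span (UH n) {v | ∃ j < N, v = act wt (longNeg i j) (wGen wt)} := by
  have hp : ∀ p : ℕ, ∃ η : UH n, 1 ≤ p → act wt (longCartan i p) (wGen wt) = η • wGen wt :=
    fun p => by
      by_cases h : 1 ≤ p
      · have hc : longCartan i p ∈ hPlus n := basisElt_mem_hPlus (by omega) _
        exact ⟨UniversalEnvelopingAlgebra.ι ℂ ⟨_, hc⟩, fun _ => act_hPlus wt ⟨_, hc⟩⟩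
      · exact ⟨0, fun h' => absurd h' h⟩
  choose η hη using hp
  refine garland_finite (f := fun m => act wt (longNeg i m)) (h := fun p => act wt (longCartan i p))
    (e := act wt (longPos i)) (η := η) ?_ ?_ ?_ hη ?_ m
  · intro m v
    rw [act_lie, lie_longPos_longNeg, add_comm]
  · intro p m v
    have h2 : algebraMap ℂ (UH n) (-2) = -2 := by rw [map_neg, map_ofNat]
    rw [act_lie, lie_longCartan_longNeg, act_smul, add_comm, sub_eq_add_neg, ← neg_smul, h2]
  · exact act_nPlus wt ((nPlus n).smul_mem _ (basisElt_mem_nPlus (lo_lt_hi i i) _))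
  · rw [act_pow, longNeg_zero]
    exact rel_wGen wt (.xNeg _ N hN)

/-! ### Finite generation of `C𝔫^- w_λ` -/

/-- The spanning vectors of `C𝔫^-` of bounded degree. -/
def lowerSet (n : ℕ) (K : ℤ) : Set (currentAlg n) :=
  {x | ∃ a b k h, b < a ∧ k ≤ K ∧ x = basisElt a b k h}

theorem lowerSet_finite (n : ℕ) (K : ℤ) : (lowerSet n K).Finite := by
  classical
  let F : Fin (2 * n + 1) × Fin (2 * n + 1) × ℤ → currentAlg n := fun p =>
    if h : Nonneg p.1 p.2.1 p.2.2 then basisElt p.1 p.2.1 p.2.2 h else 0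
  have hfin : (Set.univ ×ˢ Set.univ ×ˢ Set.Icc (-1) K :
      Set (Fin (2 * n + 1) × Fin (2 * n + 1) × ℤ)).Finite :=
    Set.finite_univ.prod (Set.finite_univ.prod (Set.finite_Icc _ _))
  refine (hfin.image F).subset ?_
  rintro _ ⟨a, b, k, h, -, hk, rfl⟩
  have h1 : -1 ≤ k := by
    have h' := h
    unfold Nonneg idxDeg at h'
    split_ifs at h' <;> omega
  exact ⟨(a, b, k), ⟨trivial, trivial, h1, hk⟩, dif_pos h⟩

/-- This transfers the finiteness for the long root `2ε_i` to the whole column `lo i`, since for `a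
< hi i` the left factor of the bracket is in `C𝔫^+`. -/
theorem lie_basisElt_longNeg (i : Fin n) {a : Fin (2 * n + 1)} (h1 : a ≠ lo i) (h2 : a ≠ hi i)
    {p k : ℤ} (m : ℕ) (hp : Nonneg a (hi i) p) (hk : Nonneg a (lo i) k)
    (e : k = p + (2 * m - 1)) :
    ⁅basisElt a (hi i) p hp, longNeg i m⁆ = basisElt a (lo i) k hk := by
  apply Subtype.ext
  change ⁅basisMat a (hi i) p, mat (longNeg i m)⁆ = basisMat a (lo i) k
  have h3 : a.rev ≠ hi i := fun h => h1 (by rw [← Fin.rev_rev a, h, rev_hi])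
  have ho : Odd (2 * (m : ℤ) - 1) := ⟨m - 1, by ring⟩
  rw [basisMat_of_ne h2, basisMat_of_ne h1, mat_longNeg, LieRing.of_associative_ring_bracket,
    twist, twist, e, zsign_add, ho.neg_one_zpow, sub_mul, mul_sub, el_mul_same, smul_mul_assoc,
    mul_smul_comm, rev_hi, rev_lo, el_mul_same, el_mul_ne _ _ _ _ _ _ _ _ h3,
    el_mul_ne _ _ _ _ _ _ _ _ h1.symm, sgn_hi, sgn_lo, add_comm (2 * (m : ℤ) - 1), mul_one]
  module

theorem basisElt_rev {a b : Fin (2 * n + 1)} (hab : a ≠ b) {k : ℤ} (h : Nonneg a b k) :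
    ∃ c : ℂ, basisElt a b k h = c • basisElt b.rev a.rev k h.rev := by
  have := twist_rev b.rev a.rev k
  rw [Fin.rev_rev, Fin.rev_rev] at this
  refine ⟨-(sgn b.rev * sgn a.rev * (-1) ^ k), Subtype.ext ?_⟩
  change basisMat a b k = (-(sgn b.rev * sgn a.rev * (-1) ^ k)) • basisMat b.rev a.rev k
  rw [basisMat_of_ne hab, basisMat_of_ne (fun h' => hab (Fin.rev_inj.1 h').symm), this]

/-- The coroot of `2ε_i` is the sum of those of `ε_i - ε_{i+1}` and `2ε_{i+1}`; the induction
descends from the last index. -/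
theorem exists_dominant_bound (wt : Module.Dual ℂ (cartan n)) (hwt : IsDominantIntegral wt) :
    ∀ i : Fin n, ∃ m : ℕ, wt (corootH (.long i)) = m := by
  suffices ∀ d : ℕ, ∀ i : Fin n, n - i.val ≤ d → ∃ m : ℕ, wt (corootH (.long i)) = m from
    fun i => this _ i le_rfl
  intro d
  induction d with
  | zero => intro i hi; omega
  | succ d ih =>
    intro i hi
    obtain ⟨m, hm⟩ := hwt i
    by_cases h : i.val + 1 < n
    · obtain ⟨m', hm'⟩ := ih ⟨i + 1, h⟩ (by simp only; omega)
      refine ⟨m + m', ?_⟩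
      rw [Nat.cast_add, ← hm, ← hm', ← map_add]
      congr 1
      apply Subtype.ext
      apply Subtype.ext
      change mat (coroot _) = mat (coroot _) + mat (coroot _)
      rw [mat_coroot, mat_coroot, mat_coroot, simpleRoot, dif_pos h]
      simp only [corootMat]
      abel
    · rw [simpleRoot, dif_neg h] at hm
      exact ⟨m, hm⟩

end

section
variable {n : ℕ} (wt : Module.Dual ℂ (cartan n))

/-- The span of the vectors `x w_λ`, `x` a spanning vector of `C𝔫^-` of bounded degree. -/
def lowerSpan (K : ℤ) : Submodule (UH n) (GlobalWeyl wt) :=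
  Submodule.span (UH n) {v | ∃ x ∈ lowerSet n K, v = act wt x (wGen wt)}

theorem act_mem_lowerSpan {K : ℤ} {a b : Fin (2 * n + 1)} {k : ℤ} (h : Nonneg a b k) (hab : b < a)
    (hk : k ≤ K) : act wt (basisElt a b k h) (wGen wt) ∈ lowerSpan wt K :=
  Submodule.subset_span ⟨_, ⟨a, b, k, h, hab, hk, rfl⟩, rfl⟩

theorem act_hi_lo_mem (i : Fin n) {N : ℕ} (hN : wt (corootH (.long i)) = N) {K : ℤ}
    (hK : 2 * N + 2 ≤ K) (k : ℤ) (h : Nonneg (hi i) (lo i) k) :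
    act wt (basisElt (hi i) (lo i) k h) (wGen wt) ∈ lowerSpan wt K := by
  have h' := h
  unfold Nonneg at h'
  rw [idxDeg_lo, idxDeg_hi] at h'
  rcases Int.even_or_odd k with hk | hk
  · have : basisElt (hi i) (lo i) k h = 0 := by
      apply Subtype.ext
      change basisMat _ _ _ = 0
      rw [basisMat_of_ne (lo_ne_hi _ _).symm, ← rev_hi, twist_rev_self _ hk]
    rw [this, act_zero]
    exact zero_mem _
  · obtain ⟨r, hr⟩ := hk
    obtain ⟨m, rfl⟩ : ∃ m : ℕ, k = 2 * m - 1 := ⟨(r + 1).toNat, by omega⟩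
    have e : basisElt (hi i) (lo i) (2 * m - 1) h = (2 : ℂ) • longNeg i m := by
      rw [longNeg, smul_smul]; norm_num
    have hle : Submodule.span (UH n) {v | ∃ j < N, v = act wt (longNeg i j) (wGen wt)} ≤
        lowerSpan wt K := by
      refine Submodule.span_le.2 ?_
      rintro _ ⟨j, hj, rfl⟩
      rw [longNeg, act_smul]
      exact Submodule.smul_mem _ _ (act_mem_lowerSpan wt _ (lo_lt_hi _ _) (by omega))
    rw [e, act_smul]
    exact Submodule.smul_mem _ _ (hle (act_longNeg_mem wt i hN m))

/-- Only odd powers occur in `longNeg`, so `p` has the parity opposite to `k`. Among `0`, `1`, `2`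
there is always such a `p` that is admissible for `(a, hi i)` and leaves `m ≥ 0`. -/
theorem exists_degree_split {i : Fin n} {a : Fin (2 * n + 1)} {k : ℤ} (h : Nonneg a (lo i) k) :
    ∃ (p : ℤ) (m : ℕ), Nonneg a (hi i) p ∧ p ≤ 2 ∧ k = p + (2 * m - 1) := by
  unfold Nonneg at h ⊢
  rw [idxDeg_hi]
  rw [idxDeg_lo] at h
  have hd : idxDeg a = 0 ∨ idxDeg a = 1 ∨ idxDeg a = 2 := by
    unfold idxDeg; split_ifs <;> simp
  rcases Int.even_or_odd k with ⟨r, hk⟩ | ⟨r, hk⟩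
  · exact ⟨1, r.toNat, by omega, by omega, by omega⟩
  · rcases hd with hd | hd | hd <;> rw [hd] at h ⊢
    · exact ⟨0, (r + 1).toNat, by omega, by omega, by omega⟩
    · exact ⟨2, r.toNat, by omega, by omega, by omega⟩
    · exact ⟨2, r.toNat, by omega, by omega, by omega⟩

/-- On `w_λ` the bracket with `longNeg` reduces to a product, because the upper triangular factor
kills `w_λ`. That factor commutes with the right action, so it carries the bound `j < N` over to
this entry, in powers at most `2 + 2(N - 1) - 1`. -/
theorem act_lo_mem (i : Fin n) {N : ℕ} (hN : wt (corootH (.long i)) = N) {K : ℤ}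
    (hK : 2 * N + 2 ≤ K) (a : Fin (2 * n + 1)) (k : ℤ) (h : Nonneg a (lo i) k) (h1 : lo i < a)
    (h2 : a ≤ hi i) : act wt (basisElt a (lo i) k h) (wGen wt) ∈ lowerSpan wt K := by
  rcases h2.eq_or_lt with rfl | h3
  · exact act_hi_lo_mem wt i hN hK k h
  obtain ⟨p, m, hp, hp2, hm⟩ := exists_degree_split h
  have hact : ∀ (j : ℕ) (l : ℤ) (h' : Nonneg a (lo i) l), l = p + (2 * j - 1) →
      act wt (basisElt a (lo i) l h') (wGen wt) =
        act wt (basisElt a (hi i) p hp) (act wt (longNeg i j) (wGen wt)) := fun j l h' e => by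
    rw [act_lie, lie_basisElt_longNeg i h1.ne' h3.ne j hp h' e,
      act_nPlus wt (basisElt_mem_nPlus h3 hp), map_zero, add_zero]
  have hle : Submodule.span (UH n) {v | ∃ j < N, v = act wt (longNeg i j) (wGen wt)} ≤
      (lowerSpan wt K).comap (act wt (basisElt a (hi i) p hp)) := by
    refine Submodule.span_le.2 ?_
    rintro _ ⟨j, hj, rfl⟩
    have h5 : Nonneg a (lo i) (p + (2 * j - 1)) := by
      unfold Nonneg at hp ⊢
      rw [idxDeg_hi] at hp
      rw [idxDeg_lo]; omega
    have h6 := act_mem_lowerSpan wt h5 h1 (K := K) (by omega)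
    rw [hact j _ h5 rfl] at h6
    exact h6
  rw [hact m k h hm]
  exact hle (act_longNeg_mem wt i hN m)

theorem exists_lowerSpan (hwt : IsDominantIntegral wt) :
    ∃ K : ℤ, ∀ a b k h, b < a → act wt (basisElt a b k h) (wGen wt) ∈ lowerSpan wt K := by
  choose N hN using exists_dominant_bound wt hwt
  obtain ⟨M, hM⟩ : ∃ M : ℕ, ∀ i, N i ≤ M :=
    ⟨Finset.univ.sup N, fun i => Finset.le_sup (Finset.mem_univ i)⟩
  refine ⟨2 * M + 2, ?_⟩
  -- The mirror symmetry exchanges `(a, b)` with `(b', a')`, so `b ≤ a'` may be assumed. Together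
  -- with `b < a` this puts `b` in the first half.
  have half : ∀ a b k h, b < a → b ≤ a.rev →
      act wt (basisElt a b k h) (wGen wt) ∈ lowerSpan wt (2 * M + 2) := by
    intro a b k h hab hb
    obtain ⟨i, rfl⟩ : ∃ i, b = lo i := by
      have h3 : b.val < n := by
        rw [Fin.le_def, Fin.val_rev] at hb
        rw [Fin.lt_def] at hab
        omega
      exact ⟨⟨b, h3⟩, rfl⟩
    have := hM i
    refine act_lo_mem wt i (hN i) (by omega) a k h hab ?_
    rw [← rev_lo, ← Fin.rev_le_rev, Fin.rev_rev]; exact hb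
  intro a b k h hab
  rcases le_total b a.rev with hb | hb
  · exact half a b k h hab hb
  · obtain ⟨c, hc⟩ := basisElt_rev hab.ne' h
    rw [hc, act_smul]
    refine Submodule.smul_mem _ _ (half _ _ _ _ (Fin.rev_lt_rev.2 hab) ?_)
    rwa [Fin.rev_rev]

/-! ### The filtration of `W(λ)` by the length of monomials -/

/-- The span of the monomials of length at most `k` in the elements of `S`, applied to `w_λ`. -/
def filt (S : Set (currentAlg n)) : ℕ → Submodule (UH n) (GlobalWeyl wt)
  | 0 => Submodule.span (UH n) {wGen wt}
  | k + 1 => filt S k ⊔ ⨆ x ∈ S, (filt S k).map (act wt x)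

variable {wt}

theorem filt_le_succ (S : Set (currentAlg n)) (k : ℕ) : filt wt S k ≤ filt wt S (k + 1) :=
  le_sup_left

theorem filt_mono (S : Set (currentAlg n)) : Monotone (filt wt S) :=
  monotone_nat_of_le_succ (filt_le_succ S)

theorem act_mem_filt {S : Set (currentAlg n)} {x : currentAlg n} (hx : x ∈ S) {k : ℕ}
    {v : GlobalWeyl wt} (hv : v ∈ filt wt S k) : act wt x v ∈ filt wt S (k + 1) :=
  le_sup_right (a := filt wt S k)
    (le_iSup₂_of_le (f := fun x (_ : x ∈ S) => (filt wt S k).map (act wt x)) x hx le_rfl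
      (Submodule.mem_map_of_mem hv))

theorem filt_succ_le {S : Set (currentAlg n)} {k : ℕ} {T : Submodule (UH n) (GlobalWeyl wt)}
    (h0 : filt wt S k ≤ T) (h1 : ∀ x ∈ S, filt wt S k ≤ T.comap (act wt x)) :
    filt wt S (k + 1) ≤ T :=
  sup_le h0 (iSup₂_le fun x hx => Submodule.map_le_iff_le_comap.2 (h1 x hx))

theorem filt_fg {S : Set (currentAlg n)} (hS : S.Finite) (k : ℕ) : (filt wt S k).FG := by
  induction k with
  | zero => exact Submodule.fg_span_singleton _
  | succ k ih =>
    refine ih.sup ?_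
    have := Submodule.fg_biSup hS.toFinset (fun x => (filt wt S k).map (act wt x))
      fun x _ => ih.map _
    simpa only [Set.Finite.mem_toFinset] using this

theorem act_diag_mem (a : Fin (2 * n + 1)) (k : ℤ) (h : Nonneg a a k) :
    act wt (basisElt a a k h) (wGen wt) ∈ Submodule.span (UH n) {wGen wt} := by
  have hk : 0 ≤ k := by unfold Nonneg at h; omega
  rw [Submodule.mem_span_singleton]
  rcases hk.eq_or_lt with rfl | hk
  · exact ⟨_, (act_cartan wt ⟨_, basisElt_mem_cartan a h⟩).symm⟩
  · exact ⟨_, (act_hPlus wt ⟨_, basisElt_mem_hPlus hk h⟩).symm⟩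

/-- Both parts follow from `x s v = [x, s] v + s x v`, and have to be proved together: in the
second, `[x, s]` is arbitrary and is controlled by the first. At length zero, the lower triangular
elements are controlled by `hK` and the others send `w_λ` into its own span. -/
theorem act_filt {K : ℤ}
    (hK : ∀ a b k h, b < a → act wt (basisElt a b k h) (wGen wt) ∈ lowerSpan wt K) (k : ℕ) :
    (∀ x : currentAlg n,
      filt wt (lowerSet n K) k ≤ (filt wt (lowerSet n K) (k + 1)).comap (act wt x)) ∧
    ∀ a b l h, a ≤ b →
      filt wt (lowerSet n K) k ≤ (filt wt (lowerSet n K) k).comap (act wt (basisElt a b l h)) := by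
  set S := lowerSet n K
  induction k with
  | zero =>
    have hB : ∀ a b l h, a ≤ b →
        filt wt S 0 ≤ (filt wt S 0).comap (act wt (basisElt a b l h)) := by
      intro a b l h hab
      refine (Submodule.span_singleton_le_iff_mem _ _).2 ?_
      rw [Submodule.mem_comap]
      rcases hab.eq_or_lt with rfl | hab
      · exact act_diag_mem a l h
      · rw [act_nPlus wt (basisElt_mem_nPlus hab h)]; exact zero_mem _
    refine ⟨fun x => act_mem_of_span wt (B := {x | ∃ a b k h, x = basisElt a b k h}) ?_
      (by rw [span_basisElt]; trivial), hB⟩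
    rintro _ ⟨a, b, k, h, rfl⟩
    rcases le_or_gt a b with hab | hab
    · exact (hB a b k h hab).trans (Submodule.comap_mono (filt_le_succ S 0))
    · refine (Submodule.span_singleton_le_iff_mem _ _).2 ?_
      refine (Submodule.span_le.2 ?_ : lowerSpan wt K ≤ filt wt S 1) (hK a b k h hab)
      rintro _ ⟨x, hx, rfl⟩
      exact act_mem_filt hx (Submodule.mem_span_singleton_self _)
  | succ k ih =>
    constructor
    · intro x
      refine filt_succ_le ((ih.1 x).trans (Submodule.comap_mono (filt_le_succ S _))) ?_
      intro s hs v hv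
      rw [Submodule.mem_comap, Submodule.mem_comap, act_lie]
      exact add_mem (filt_le_succ S _ (ih.1 _ hv)) (act_mem_filt hs (ih.1 _ hv))
    · intro a b l h hab
      refine filt_succ_le ((ih.2 a b l h hab).trans (Submodule.comap_mono (filt_le_succ S _))) ?_
      intro s hs v hv
      rw [Submodule.mem_comap, Submodule.mem_comap, act_lie]
      exact add_mem (ih.1 _ hv) (act_mem_filt hs (ih.2 a b l h hab hv))

theorem exists_mem_filt {K : ℤ}
    (hK : ∀ a b k h, b < a → act wt (basisElt a b k h) (wGen wt) ∈ lowerSpan wt K)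
    (v : GlobalWeyl wt) : ∃ k, v ∈ filt wt (lowerSet n K) k := by
  obtain ⟨y, rfl⟩ := toWeyl_surjective wt v
  rw [toWeyl_apply]
  have h0 : ∃ k, wGen wt ∈ filt wt (lowerSet n K) k := ⟨0, Submodule.mem_span_singleton_self _⟩
  generalize wGen wt = v at h0
  induction y using uea_induction generalizing v with
  | h1 r =>
    obtain ⟨k, hk⟩ := h0
    refine ⟨k, ?_⟩
    rw [algebraMap_smul, ← algebraMap_uh_smul]
    exact Submodule.smul_mem _ _ hk
  | h2 x =>
    obtain ⟨k, hk⟩ := h0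
    exact ⟨k + 1, (act_filt hK k).1 x hk⟩
  | h3 a b ha hb => rw [mul_smul]; exact ha _ (hb _ h0)
  | h4 a b ha hb =>
    obtain ⟨k, hk⟩ := ha _ h0
    obtain ⟨l, hl⟩ := hb _ h0
    refine ⟨max k l, ?_⟩
    rw [add_smul]
    exact add_mem (filt_mono _ (le_max_left _ _) hk) (filt_mono _ (le_max_right _ _) hl)

end

/-! ### Weights -/

/-- The coordinate `ε_i` of the weight of a matrix index. -/
def eps {n : ℕ} (i : Fin n) (a : Fin (2 * n + 1)) : ℤ :=
  (if a = lo i then 1 else 0) - (if a = hi i then 1 else 0)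

theorem lo_inj {n : ℕ} {i j : Fin n} : lo i = lo j ↔ i = j :=
  ⟨fun h => by_contra fun h' => lo_ne_lo h' h, fun h => by rw [h]⟩

theorem hi_inj {n : ℕ} {i j : Fin n} : hi i = hi j ↔ i = j :=
  ⟨fun h => by_contra fun h' => hi_ne_hi h' h, fun h => by rw [h]⟩

theorem eps_lo {n : ℕ} (i j : Fin n) : eps i (lo j) = if i = j then 1 else 0 := by
  simp only [eps, lo_inj, if_neg (lo_ne_hi j i), sub_zero, @eq_comm _ j]

theorem eps_hi {n : ℕ} (i j : Fin n) : eps i (hi j) = -(if i = j then 1 else 0) := by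
  simp only [eps, hi_inj, if_neg (lo_ne_hi i j).symm, zero_sub, @eq_comm _ j]

theorem eps_mid {n : ℕ} (i : Fin n) : eps i (mid n) = 0 := by
  simp [eps, (lo_ne_mid i).symm, (hi_ne_mid i).symm]

theorem eps_rev {n : ℕ} (i : Fin n) (a : Fin (2 * n + 1)) : eps i a.rev = -eps i a := by
  rcases index_cases a with ⟨j, rfl⟩ | rfl | ⟨j, rfl⟩
  · rw [rev_lo, eps_lo, eps_hi]
  · rw [rev_mid, eps_mid, neg_zero]
  · rw [rev_hi, eps_lo, eps_hi, neg_neg]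

theorem sum_eps {n : ℕ} (a : Fin (2 * n + 1)) : ∑ i : Fin n, eps i a = idxDeg a - 1 := by
  rcases index_cases a with ⟨j, rfl⟩ | rfl | ⟨j, rfl⟩
  · simp [eps_lo, idxDeg_lo]
  · simp [eps_mid, idxDeg_mid]
  · simp [eps_hi, idxDeg_hi]

theorem sum_height_eps {n : ℕ} (a : Fin (2 * n + 1)) :
    ∑ i : Fin n, ((n : ℤ) - i) * eps i a = n - a := by
  rcases index_cases a with ⟨j, rfl⟩ | rfl | ⟨j, rfl⟩
  · simp only [eps_lo]
    simp
    rfl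
  · simp only [eps_mid]
    simp [mid]
  · have : (((hi j).val : ℕ) : ℤ) = 2 * n - j := by simp only [hi]; omega
    simp only [eps_hi, this]
    simp
    ring

theorem corootMat_mul_el {n : ℕ} (i : Fin n) (a b : Fin (2 * n + 1)) (k : ℤ) :
    corootMat (.long i) * el a b 1 k = (eps i a : ℂ) • el a b 1 k := by
  rw [corootMat, sub_mul, el_mul, el_mul, zero_add]
  by_cases h1 : lo i = a
  · subst h1; rw [if_pos rfl, if_neg (lo_ne_hi _ _).symm, eps_lo]; simp
  · by_cases h2 : hi i = a
    · subst h2; rw [if_pos rfl, if_neg h1, eps_hi]; simp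
    · simp [eps, h1, h2, Ne.symm h1, Ne.symm h2]

theorem el_mul_corootMat {n : ℕ} (i : Fin n) (a b : Fin (2 * n + 1)) (k : ℤ) :
    el a b 1 k * corootMat (.long i) = (eps i b : ℂ) • el a b 1 k := by
  rw [corootMat, mul_sub, el_mul, el_mul, add_zero]
  by_cases h1 : b = lo i
  · subst h1; rw [if_pos rfl, if_neg (lo_ne_hi _ _), eps_lo]; simp
  · by_cases h2 : b = hi i
    · subst h2; rw [if_pos rfl, if_neg h1, eps_hi]; simp
    · simp [eps, h1, h2, eq_comm]

theorem lie_corootMat_twist {n : ℕ} (i : Fin n) (a b : Fin (2 * n + 1)) (k : ℤ) :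
    ⁅corootMat (.long i), twist a b k⁆ = ((eps i a - eps i b : ℤ) : ℂ) • twist a b k := by
  rw [LieRing.of_associative_ring_bracket, twist, mul_sub, sub_mul, mul_smul_comm, smul_mul_assoc,
    corootMat_mul_el, corootMat_mul_el, el_mul_corootMat, el_mul_corootMat, eps_rev, eps_rev]
  push_cast
  module

theorem lie_coroot_basisElt {n : ℕ} (i : Fin n) (a b : Fin (2 * n + 1)) (k : ℤ)
    (h : Nonneg a b k) :
    ⁅coroot (.long i), basisElt a b k h⁆ = ((eps i a - eps i b : ℤ) : ℂ) • basisElt a b k h := by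
  apply Subtype.ext
  change ⁅mat (coroot (.long i)), basisMat a b k⁆ = _ • basisMat a b k
  rw [mat_coroot, basisMat, lie_sub, lie_corootMat_twist]
  split_ifs with hab
  · subst hab
    rw [lie_corootMat_twist, sub_self, sub_self]; simp
  · simp

section
variable {n : ℕ} {wt : Module.Dual ℂ (cartan n)}

/-- `v` is a weight vector of weight `∑ μ_i ε_i`. -/
def IsWt (μ : Fin n → ℤ) (v : GlobalWeyl wt) : Prop :=
  ∀ i, act wt (coroot (.long i)) v = (μ i : ℂ) • v

theorem IsWt.uh_smul {μ : Fin n → ℤ} {v : GlobalWeyl wt} (h : IsWt μ v) (u : UH n) :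
    IsWt μ (u • v) := fun i => by
  rw [map_smul, h i, ← algebraMap_uh_smul, ← algebraMap_uh_smul, smul_comm]

theorem IsWt.act_of_lie {μ ν : Fin n → ℤ} {v : GlobalWeyl wt} (h : IsWt μ v) {x : currentAlg n}
    (hx : ∀ i, ⁅coroot (.long i), x⁆ = (ν i : ℂ) • x) : IsWt (μ + ν) (act wt x v) := fun i => by
  rw [act_lie, hx, act_smul, h i, ← algebraMap_uh_smul, map_smul, ← add_smul, ← map_add,
    algebraMap_uh_smul, Pi.add_apply, Int.cast_add, add_comm]

theorem IsWt.act_basisElt {μ : Fin n → ℤ} {v : GlobalWeyl wt} (hv : IsWt μ v)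
    {a b : Fin (2 * n + 1)} {k : ℤ} (h : Nonneg a b k) :
    IsWt (μ + fun i => eps i a - eps i b) (act wt (basisElt a b k h) v) :=
  hv.act_of_lie fun i => lie_coroot_basisElt i a b k h

/-- The span of weight vectors whose weight has coordinate sum at most `C` and height at
most `D`. -/
def wtSpan (wt : Module.Dual ℂ (cartan n)) (C D : ℤ) : Submodule (UH n) (GlobalWeyl wt) :=
  Submodule.span (UH n) {v | ∃ μ : Fin n → ℤ, IsWt μ v ∧ ∑ i, μ i ≤ C ∧
    ∑ i : Fin n, ((n : ℤ) - i) * μ i ≤ D}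

theorem wtSpan_mono {C D D' : ℤ} (h : D ≤ D') : wtSpan wt C D ≤ wtSpan wt C D' :=
  Submodule.span_mono fun _ ⟨μ, h1, h2, h3⟩ => ⟨μ, h1, h2, h3.trans h⟩

/-- The entry `(a, b)` changes the coordinate sum by `idxDeg a - idxDeg b ≤ 0` and the height by `b
- a ≤ -1`. -/
theorem wtSpan_act {K C D : ℤ} {x : currentAlg n} (hx : x ∈ lowerSet n K) :
    wtSpan wt C D ≤ (wtSpan wt C (D - 1)).comap (act wt x) := by
  obtain ⟨a, b, k, h, hab, -, rfl⟩ := hx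
  refine Submodule.span_le.2 ?_
  rintro v ⟨μ, h1, h2, h3⟩
  refine Submodule.subset_span ⟨_, h1.act_basisElt h, ?_, ?_⟩
  · simp only [Pi.add_apply, Finset.sum_add_distrib, Finset.sum_sub_distrib, sum_eps]
    have := idxDeg_antitone hab.le
    omega
  · simp only [Pi.add_apply, mul_add, mul_sub, Finset.sum_add_distrib, Finset.sum_sub_distrib,
      sum_height_eps]
    have := Fin.lt_def.1 hab
    omega

theorem filt_le_wtSpan {K C D : ℤ} (hw : wGen wt ∈ wtSpan wt C D) (k : ℕ) :
    filt wt (lowerSet n K) k ≤ wtSpan wt C D := by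
  induction k with
  | zero => exact (Submodule.span_singleton_le_iff_mem _ _).2 hw
  | succ k ih =>
    exact filt_succ_le ih fun x hx => ih.trans ((wtSpan_act hx).trans
      (Submodule.comap_mono (wtSpan_mono (by omega))))

/-- A monomial of length exactly `k + 1` has lowered the height at least `k + 1` times. -/
theorem filt_succ_le_sup {K C D : ℤ} (hw : wGen wt ∈ wtSpan wt C D) (k : ℕ) :
    filt wt (lowerSet n K) (k + 1) ≤ filt wt (lowerSet n K) k ⊔ wtSpan wt C (D - (k + 1)) := by
  induction k with
  | zero =>
    refine filt_succ_le le_sup_left fun x hx => (filt_le_wtSpan hw 0).trans ?_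
    refine (wtSpan_act hx).trans (Submodule.comap_mono (le_sup_of_le_right (le_of_eq ?_)))
    simp
  | succ k ih =>
    refine filt_succ_le le_sup_left fun x hx => ih.trans (sup_le ?_ ?_)
    · intro v hv
      exact le_sup_left (a := filt wt (lowerSet n K) (k + 1)) (act_mem_filt hx hv)
    · refine (wtSpan_act hx).trans (Submodule.comap_mono (le_sup_of_le_right (le_of_eq ?_)))
      push_cast
      ring_nf

/-! ### The weights of `W(λ)` are bounded -/

/-- Needed because independence of eigenspaces is applied over `ℂ`, whereas `wtSpan` is a span over
`UH n`. -/
theorem mem_span_complex {X : Set (GlobalWeyl wt)} (hX : ∀ (u : UH n), ∀ v ∈ X, u • v ∈ X)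
    {v : GlobalWeyl wt} (hv : v ∈ Submodule.span (UH n) X) : v ∈ Submodule.span ℂ X := by
  induction hv using Submodule.span_induction with
  | mem v hv => exact Submodule.subset_span hv
  | zero => exact zero_mem _
  | add v w _ _ hv hw => exact add_mem hv hw
  | smul u v _ hv =>
    clear * - hX hv
    induction hv using Submodule.span_induction with
    | mem v hv => exact Submodule.subset_span (hX u v hv)
    | zero => rw [smul_zero]; exact zero_mem _
    | add v w _ _ hv hw => rw [smul_add]; exact add_mem hv hw
    | smul c v _ hv =>
      rw [← algebraMap_uh_smul, smul_comm, algebraMap_uh_smul]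
      exact Submodule.smul_mem _ _ hv

/-- The coordinate sum is an eigenvalue of the sum of the long coroots. A vector with a larger sum
would lie in the span of eigenspaces for other eigenvalues. -/
theorem sum_le_of_isWt {C D : ℤ} (htop : ∀ v : GlobalWeyl wt, v ∈ wtSpan wt C D)
    {μ : Fin n → ℤ} {v : GlobalWeyl wt} (hv : IsWt μ v) (h0 : v ≠ 0) : ∑ i, μ i ≤ C := by
  by_contra hC
  let H : Module.End ℂ (GlobalWeyl wt) :=
    LieModule.toEnd ℂ (currentAlg n) (GlobalWeyl wt) (∑ i : Fin n, coroot (.long i))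
  have hH : ∀ {ν : Fin n → ℤ} {x : GlobalWeyl wt}, IsWt ν x →
      x ∈ H.eigenspace ((∑ i, ν i : ℤ) : ℂ) := by
    intro ν x hx
    rw [Module.End.mem_eigenspace_iff]
    change ⁅∑ i : Fin n, coroot (.long i), x⁆ = _
    rw [sum_lie, Int.cast_sum, Finset.sum_smul]
    exact Finset.sum_congr rfl fun i _ => hx i
  have hd := (Module.End.eigenspaces_iSupIndep H) ((∑ i, μ i : ℤ) : ℂ)
  have hle : Submodule.span ℂ {x : GlobalWeyl wt | ∃ ν : Fin n → ℤ, IsWt ν x ∧ ∑ i, ν i ≤ C ∧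
      ∑ i : Fin n, ((n : ℤ) - i) * ν i ≤ D} ≤
      ⨆ c, ⨆ (_ : c ≠ ((∑ i, μ i : ℤ) : ℂ)), H.eigenspace c := by
    refine Submodule.span_le.2 ?_
    rintro x ⟨ν, hx, h1, -⟩
    refine Submodule.mem_iSup_of_mem ((∑ i, ν i : ℤ) : ℂ) (Submodule.mem_iSup_of_mem ?_ (hH hx))
    intro h
    rw [Int.cast_inj] at h
    omega
  refine h0 (Submodule.disjoint_def.1 hd v (hH hv) (hle (mem_span_complex ?_ (htop v))))
  rintro u x ⟨ν, hx, h⟩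
  exact ⟨ν, hx.uh_smul u, h⟩

theorem lie_coroot_long_xNeg (i j : Fin n) :
    ⁅coroot (.long j), xNeg (.long i)⁆ = ((if j = i then -2 else 0 : ℤ) : ℂ) • xNeg (.long i) := by
  rw [← longNeg_zero, longNeg, lie_smul, lie_coroot_basisElt, eps_lo, eps_hi, smul_comm]
  congr 3
  by_cases h : j = i <;> simp [h]

theorem lie_coroot_long_xPos (i j : Fin n) :
    ⁅coroot (.long j), xPos (.long i)⁆ = ((if j = i then 2 else 0 : ℤ) : ℂ) • xPos (.long i) := by
  have h1 : xPos (.long i) = (2⁻¹ : ℂ) • basisElt (lo i) (hi i) 1 (nonneg_lo_hi i i le_rfl) := by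
    apply Subtype.ext
    change rootVec (.long i) = (2⁻¹ : ℂ) • basisMat (lo i) (hi i) 1
    rw [basisMat_of_ne (lo_ne_hi _ _), rootVec_long]
  rw [h1, lie_smul, lie_coroot_basisElt, eps_lo, eps_hi, smul_comm]
  congr 3
  by_cases h : j = i <;> simp [h]

theorem IsWt.act_pow {μ ν : Fin n → ℤ} {v : GlobalWeyl wt} (h : IsWt μ v) {x : currentAlg n}
    (hx : ∀ i, ⁅coroot (.long i), x⁆ = (ν i : ℂ) • x) (k : ℕ) :
    IsWt (μ + k • ν) ((act wt x ^ k) v) := by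
  induction k with
  | zero => simpa using h
  | succ k ih =>
    rw [pow_succ', Module.End.mul_apply, succ_nsmul, ← add_assoc]
    exact ih.act_of_lie hx

/-- This plays the role of the reflection in `2ε_i`: go down to a lowest weight vector of the long
root `sl₂`, then climb to the opposite end of its string. The other coordinates are untouched
because the long roots are orthogonal. -/
theorem exists_raised_weight (i : Fin n) {N : ℕ} (hN : wt (corootH (.long i)) = N)
    {μ : Fin n → ℤ} {v : GlobalWeyl wt} (hv : IsWt μ v) (h0 : v ≠ 0) :
    ∃ (ν : Fin n → ℤ) (v' : GlobalWeyl wt), IsWt ν v' ∧ v' ≠ 0 ∧ |μ i| ≤ ν i ∧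
      ∀ j, j ≠ i → ν j = μ j := by
  by_cases hμ : 0 ≤ μ i
  · exact ⟨μ, v, hv, h0, (abs_of_nonneg hμ).le, fun _ _ => rfl⟩
  obtain ⟨l, hl1, hl2⟩ := Nat.exists_not_and_succ_of_not_zero_of_exists
    (p := fun k => inc (xNeg (.long i)) ^ k • v = 0) (by simpa using h0)
    (xNeg_locally_nilpotent wt (.long i) N hN v)
  rw [← HyperspecialA.act_pow] at hl1 hl2
  have hwl := hv.act_pow (lie_coroot_long_xNeg i) l
  set v₁ := (act wt (xNeg (.long i)) ^ l) v
  -- The lowest vector `v₁` has coordinate `μ i - 2l = -q`; raising it `q` times gives `q = 2l - μ i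
  -- ≥ |μ i|`.
  obtain ⟨q, hq⟩ : ∃ q : ℕ, (q : ℤ) = 2 * l - μ i := ⟨(2 * l - μ i).toNat, by omega⟩
  have hh : coroot (.long i) ≠ (0 : currentAlg n) := by
    intro hh
    have h1 := hv i
    rw [hh, act_zero, eq_comm, smul_eq_zero_iff_left h0, Int.cast_eq_zero] at h1
    omega
  have t : IsSl2Triple (coroot (.long i)) (xPos (.long i)) (xNeg (.long i)) :=
    { h_ne_zero := hh
      lie_e_f := rfl
      lie_h_e_nsmul := by rw [lie_coroot_xPos, two_smul, two_nsmul]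
      lie_h_f_nsmul := by rw [lie_coroot_xNeg, two_smul, two_nsmul] }
  -- In the opposite triple, with `e` and `f` exchanged, a lowest weight vector is primitive.
  have P : t.symm.HasPrimitiveVectorWith v₁ (q : ℂ) :=
    { ne_zero := hl1
      lie_h := by
        have h1 : ⁅coroot (.long i), v₁⁆ = _ := hwl i
        rw [neg_lie, h1, ← neg_smul]
        congr 1
        have : (q : ℂ) = ((q : ℤ) : ℂ) := by simp
        rw [this, hq]
        simp
        ring
      lie_e := by
        rw [pow_succ', Module.End.mul_apply] at hl2
        exact hl2 }
  have hne := P.pow_toEnd_f_ne_zero_of_eq_nat rfl (le_refl q)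
  rw [toEnd_pow_eq, ← HyperspecialA.act_pow] at hne
  refine ⟨_, _, hwl.act_pow (lie_coroot_long_xPos i) q, hne, ?_, ?_⟩
  · simp
    rw [abs_of_neg (by omega)]
    omega
  · intro j hj
    simp [hj]

/-- Raising the coordinates one after another leads to a nonzero weight vector with coordinates at
least `|μ i|`, to which the bound on the sum applies. -/
theorem sum_abs_le_of_isWt (hN : ∀ i : Fin n, ∃ m : ℕ, wt (corootH (.long i)) = m) {C D : ℤ}
    (htop : ∀ v : GlobalWeyl wt, v ∈ wtSpan wt C D)
    {μ : Fin n → ℤ} {v : GlobalWeyl wt} (hv : IsWt μ v) (h0 : v ≠ 0) : ∑ i, |μ i| ≤ C := by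
  classical
  have key : ∀ s : Finset (Fin n), ∃ (ν : Fin n → ℤ) (v' : GlobalWeyl wt), IsWt ν v' ∧ v' ≠ 0 ∧
      (∀ i ∈ s, |μ i| ≤ ν i) ∧ ∀ j, j ∉ s → ν j = μ j := by
    intro s
    induction s using Finset.induction_on with
    | empty => exact ⟨μ, v, hv, h0, by simp, fun _ _ => rfl⟩
    | insert i s hi ih =>
      obtain ⟨ν, v', h1, h2, h3, h4⟩ := ih
      obtain ⟨N, hN⟩ := hN i
      obtain ⟨ν', v'', h5, h6, h7, h8⟩ := exists_raised_weight i hN h1 h2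
      refine ⟨ν', v'', h5, h6, fun j hj => ?_, fun j hj => ?_⟩
      · rcases eq_or_ne j i with rfl | hji
        · rwa [h4 j hi] at h7
        · rw [h8 j hji]
          exact h3 j (Finset.mem_of_mem_insert_of_ne hj hji)
      · rw [Finset.mem_insert, not_or] at hj
        rw [h8 j hj.1, h4 j hj.2]
  obtain ⟨ν, v', h1, h2, h3, -⟩ := key Finset.univ
  exact (Finset.sum_le_sum fun i hi => h3 i hi).trans (sum_le_of_isWt htop h1 h2)

theorem wtSpan_eq_bot (hN : ∀ i : Fin n, ∃ m : ℕ, wt (corootH (.long i)) = m) {C D : ℤ}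
    (htop : ∀ v : GlobalWeyl wt, v ∈ wtSpan wt C D) {D' : ℤ} (hD : D' < -(n * C)) :
    wtSpan wt C D' = ⊥ := by
  refine Submodule.span_eq_bot.2 ?_
  rintro v ⟨μ, hv, -, h⟩
  by_contra h0
  have h1 := sum_abs_le_of_isWt hN htop hv h0
  have h2 : -(n * ∑ i, |μ i|) ≤ ∑ i : Fin n, ((n : ℤ) - i) * μ i := by
    rw [Finset.mul_sum, ← Finset.sum_neg_distrib]
    refine Finset.sum_le_sum fun i _ => ?_
    have hi := i.2
    have h3 : ((n : ℤ) - i) * (-|μ i|) ≤ ((n : ℤ) - i) * μ i :=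
      mul_le_mul_of_nonneg_left (neg_abs_le _) (by omega)
    have h4 : 0 ≤ (i : ℤ) * |μ i| := by positivity
    linarith
  have h5 : (n : ℤ) * ∑ i, |μ i| ≤ n * C := mul_le_mul_of_nonneg_left h1 (by positivity)
  omega

/-- The global Weyl module is finitely generated for the right action of `U(C𝔥_+)`. -/
theorem finite_uh (hwt : IsDominantIntegral wt) : Module.Finite (UH n) (GlobalWeyl wt) := by
  obtain ⟨K, hK⟩ := exists_lowerSpan wt hwt
  have hN := exists_dominant_bound wt hwt
  choose N hN' using hN
  let C : ℤ := ∑ i, (N i : ℤ)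
  let D : ℤ := ∑ i : Fin n, ((n : ℤ) - i) * N i
  have hw : wGen wt ∈ wtSpan wt C D := by
    refine Submodule.subset_span ⟨fun i => N i, fun i => ?_, le_rfl, le_rfl⟩
    rw [Int.cast_natCast, ← hN']
    exact (isHighest_wGen wt).2 (corootH (.long i))
  have htop : ∀ v : GlobalWeyl wt, v ∈ wtSpan wt C D := fun v => by
    obtain ⟨k, hk⟩ := exists_mem_filt hK v
    exact filt_le_wtSpan hw k hk
  -- Monomials longer than `L` would have height below `-(n * C)`, where no weights exist.
  obtain ⟨L, hL⟩ : ∃ L : ℕ, D + n * C < L := ⟨(D + n * C + 1).toNat, by omega⟩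
  have hstab : ∀ k, filt wt (lowerSet n K) (L + k) ≤ filt wt (lowerSet n K) L := by
    intro k
    induction k with
    | zero => exact le_rfl
    | succ k ih =>
      refine (filt_succ_le_sup hw (L + k)).trans (sup_le ih ?_)
      rw [wtSpan_eq_bot (fun i => ⟨_, hN' i⟩) htop (by push_cast; omega)]
      exact bot_le
  refine ⟨?_⟩
  have : (⊤ : Submodule (UH n) (GlobalWeyl wt)) = filt wt (lowerSet n K) L := by
    refine (eq_top_iff.2 fun v _ => ?_).symm
    obtain ⟨k, hk⟩ := exists_mem_filt hK v
    exact hstab k (filt_mono _ (Nat.le_add_left k L) hk)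
  rw [this]
  exact filt_fg (lowerSet_finite n K) L

end

/-! ### Maximal ideals of algebras of countable dimension -/

/-- If `x` in the residue field were transcendental, the elements `1/(x - c)`, `c ∈ ℂ`, would be
linearly independent and uncountable in number. So the residue field is algebraic over `ℂ`, hence
equal to it. -/
theorem exists_sub_mem_of_isMaximal {U : Type} [CommRing U] [Algebra ℂ U]
    (hU : Module.rank ℂ U ≤ Cardinal.aleph0) (M : Ideal U) (hM : M.IsMaximal) (u : U) :
    ∃ c : ℂ, u - algebraMap ℂ U c ∈ M := by
  let _ := Ideal.Quotient.field M
  have hr : Module.rank ℂ (U ⧸ M) ≤ Cardinal.aleph0 :=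
    ((Ideal.Quotient.mkₐ ℂ M).toLinearMap.rank_le_of_surjective
      (Ideal.Quotient.mkₐ_surjective ℂ M)).trans hU
  have halg : Algebra.IsAlgebraic ℂ (U ⧸ M) := ⟨fun x => by
    by_contra hx
    have h1 := (Transcendental.linearIndependent_sub_inv (F := ℂ) hx).cardinal_le_rank
    rw [Cardinal.mk_complex] at h1
    exact absurd (h1.trans hr) (not_le.2 Cardinal.aleph0_lt_continuum)⟩
  obtain ⟨c, hc⟩ := (IsAlgClosed.algebraMap_bijective_of_isIntegral (k := ℂ) (K := U ⧸ M)).2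
    (Ideal.Quotient.mk M u)
  refine ⟨c, ?_⟩
  rw [← Ideal.Quotient.eq, ← hc]
  rfl

theorem rank_currentAlg (n : ℕ) : Module.rank ℂ (currentAlg n) ≤ Cardinal.aleph0 := by
  have hc : {x : currentAlg n | ∃ a b k h, x = basisElt a b k h}.Countable := by
    let F : {p : Fin (2 * n + 1) × Fin (2 * n + 1) × ℤ // Nonneg p.1 p.2.1 p.2.2} → currentAlg n :=
      fun p => basisElt _ _ _ p.2
    refine (Set.countable_range F).mono ?_
    rintro _ ⟨a, b, k, h, rfl⟩
    exact ⟨⟨(a, b, k), h⟩, rfl⟩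
  have h := rank_span_le (R := ℂ) {x : currentAlg n | ∃ a b k h, x = basisElt a b k h}
  rw [span_basisElt, rank_top] at h
  exact h.trans (Cardinal.le_aleph0_iff_set_countable.2 hc)

theorem rank_UH (n : ℕ) : Module.rank ℂ (UH n) ≤ Cardinal.aleph0 := by
  have h1 : Module.rank ℂ (hPlus n) ≤ Cardinal.aleph0 :=
    (Submodule.rank_le (hPlus n).toSubmodule).trans (rank_currentAlg n)
  let B := Module.Basis.ofVectorSpace ℂ (hPlus n)
  let s : Set (UH n) := Set.range fun i => (UniversalEnvelopingAlgebra.ι ℂ (B i) : UH n)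
  have hs : Cardinal.mk s ≤ Cardinal.aleph0 :=
    Cardinal.mk_range_le.trans (B.mk_eq_rank''.le.trans h1)
  have htop : Algebra.adjoin ℂ s = ⊤ := by
    refine Algebra.eq_top_iff.2 fun u => ?_
    induction u using uea_induction with
    | h1 r => exact Subalgebra.algebraMap_mem _ r
    | h2 x =>
      have hx : x ∈ Submodule.span ℂ (Set.range B) := by rw [B.span_eq]; trivial
      induction hx using Submodule.span_induction with
      | mem x hx => obtain ⟨i, rfl⟩ := hx; exact Algebra.subset_adjoin ⟨i, rfl⟩
      | zero => rw [map_zero]; exact zero_mem _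
      | add x y _ _ hx hy => rw [map_add]; exact add_mem hx hy
      | smul c x _ hx => rw [map_smul]; exact Subalgebra.smul_mem _ hx c
    | h3 a b ha hb => exact mul_mem ha hb
    | h4 a b ha hb => exact add_mem ha hb
  have h2 := Algebra.rank_adjoin_le (R := ℂ) s
  rw [htop, ← Subalgebra.rank_toSubmodule, Algebra.top_toSubmodule, rank_top] at h2
  exact h2.trans (max_le hs le_rfl)

/-! ### Finiteness over `A_λ` and finite-dimensionality of local Weyl modules -/

section
variable {n : ℕ} {wt : Module.Dual ℂ (cartan n)}

instance : IsScalarTower (UH n) (WeylAlg wt) (GlobalWeyl wt) where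
  smul_assoc u a v := by
    rw [Algebra.smul_def, mul_smul]; rfl

theorem finite_weylAlg (hwt : IsDominantIntegral wt) :
    Module.Finite (WeylAlg wt) (GlobalWeyl wt) := by
  have := finite_uh hwt
  exact Module.Finite.of_restrictScalars_finite (UH n) (WeylAlg wt) (GlobalWeyl wt)

theorem finiteDimensional_localWeyl (hwt : IsDominantIntegral wt) (I : Ideal (WeylAlg wt))
    (hI : I.IsMaximal) : FiniteDimensional ℂ (LocalWeyl wt I) := by
  have hsurj : Function.Surjective (algebraMap (UH n) (WeylAlg wt)) :=
    Ideal.Quotient.mk_surjective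
  -- The ideal is pulled back to `UH n`, whose dimension is known to be countable; this makes every
  -- element of `A_λ` a scalar modulo `I`.
  have hmax := Ideal.comap_isMaximal_of_surjective (algebraMap (UH n) (WeylAlg wt)) hsurj (K := I)
  have hscal : ∀ a : WeylAlg wt, ∃ c : ℂ,
      a - algebraMap (UH n) (WeylAlg wt) (algebraMap ℂ (UH n) c) ∈ I := fun a => by
    obtain ⟨u, rfl⟩ := hsurj a
    obtain ⟨c, hc⟩ := exists_sub_mem_of_isMaximal (rank_UH n) _ hmax u
    refine ⟨c, ?_⟩
    rwa [Ideal.mem_comap, map_sub] at hc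
  obtain ⟨s, hs⟩ := (finite_weylAlg hwt).fg_top
  have hmul : ∀ (a : WeylAlg wt), ∃ c : ℂ, ∀ v : GlobalWeyl wt,
      (v ⊗ₜ Ideal.Quotient.mk I a : LocalWeyl wt I) = c • (v ⊗ₜ Ideal.Quotient.mk I 1) := fun a => by
    obtain ⟨c, hc⟩ := hscal a
    refine ⟨c, fun v => ?_⟩
    have h1 : Ideal.Quotient.mk I a =
        algebraMap (UH n) (WeylAlg wt) (algebraMap ℂ (UH n) c) • Ideal.Quotient.mk I 1 := by
      rw [(Ideal.Quotient.eq).2 hc, map_one, ← Algebra.algebraMap_eq_smul_one]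
      rfl
    rw [h1, ← TensorProduct.smul_tmul, algebraMap_smul_weyl, algebraMap_uh_smul,
      TensorProduct.smul_tmul']
  -- Since `A_λ` acts on the second tensor factor through scalars, generators over `A_λ` become a
  -- spanning set over `ℂ`.
  have htop : Submodule.span ℂ ((fun v : GlobalWeyl wt =>
      (v ⊗ₜ Ideal.Quotient.mk I 1 : LocalWeyl wt I)) '' s) = ⊤ := by
    refine eq_top_iff.2 fun x _ => ?_
    induction x using TensorProduct.induction_on with
    | zero => exact zero_mem _
    | add x y hx hy => exact add_mem (hx trivial) (hy trivial)
    | tmul v b =>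
      obtain ⟨b, rfl⟩ := Ideal.Quotient.mk_surjective b
      obtain ⟨c, hc⟩ := hmul b
      rw [hc]
      refine Submodule.smul_mem _ _ ?_
      have hv : v ∈ Submodule.span (WeylAlg wt) (s : Set (GlobalWeyl wt)) := by rw [hs]; trivial
      clear * - hv hmul
      induction hv using Submodule.span_induction with
      | mem v hv => exact Submodule.subset_span ⟨v, hv, rfl⟩
      | zero => rw [TensorProduct.zero_tmul]; exact zero_mem _
      | add v w _ _ hv hw => rw [TensorProduct.add_tmul]; exact add_mem hv hw
      | smul a v _ hv =>
        obtain ⟨c, hc⟩ := hmul a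
        have h1 : a • Ideal.Quotient.mk I 1 = Ideal.Quotient.mk I a := by
          rw [map_one, ← Algebra.algebraMap_eq_smul_one]; rfl
        rw [TensorProduct.smul_tmul, h1, hc]
        exact Submodule.smul_mem _ _ hv
  exact ⟨⟨(s.finite_toSet.image _).toFinset, by rwa [Set.Finite.coe_toFinset]⟩⟩

end

end HyperspecialA

theorem proposition6p2 (n : ℕ) (hn : 1 ≤ n)
    (wt : Module.Dual ℂ (HyperspecialA.cartan n)) (hwt : HyperspecialA.IsDominantIntegral wt) :
    Module.Finite (HyperspecialA.WeylAlg wt) (HyperspecialA.GlobalWeyl wt) ∧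
      ∀ I : Ideal (HyperspecialA.WeylAlg wt), I.IsMaximal →
        FiniteDimensional ℂ (HyperspecialA.LocalWeyl wt I) :=
  ⟨HyperspecialA.finite_weylAlg hwt, HyperspecialA.finiteDimensional_localWeyl hwt⟩
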